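/- **Corollary (linear stochastic approximation, Hurwitz $A$).** Let $d\ge 1$, let $A\in\mathbb R^{d\times d}$ be Hurwitz (every complex eigenvalue of $A$ has negative real part) and let $b\in\mathbb R^d$. Then the equation $Ax+b=0$ has a unique solution $x^\star$. Let $p>1$, $\alpha>0$, $K>0$ and $\xi\in\mathbb R$, put $\alpha_k=\alpha(k+K)^{-\xi}$ for $k\ge 0$, and let $\|\cdot\|$ be the Euclidean norm on $\mathbb R^d$. Consider the recursion $$x_{k+1}=x_k+\alpha_k\,(Ax_k+b+w_k),\qquad k\ge 0,\tag{1}$$ where $x_0$ and $w_0,w_1,\dots$ are random vectors in $\mathbb R^d$ on a common probability space. Write $\mathcal F_k=\sigma(x_0,\dots,x_k)$ and call the pair $(x_k),(w_k)$ *admissible* if (1) holds and * each $w_k$ is integrable and $\mathbb E[w_k\mid\mathcal F_k]=0$ almost surely, for all $k\ge 0$; * there are constants $A_p>0$ and $B_p\ge 0$ such that, for all $k\ge 0$, $\mathbb E[\|w_k\|^p\mid\mathcal F_k]\le A_p+B_p\|x_k-x^\star\|^p$ almost surely. Then the following are equivalent: 1. for every probability space and every admissible pair on it, $x_k\to x^\star$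 almost surely; 2. $\xi\in\left(\tfrac1p,1\right]$. -/

import Mathlib

open MeasureTheory Filter Topology

/-- A real square matrix is Hurwitz if all its (complex) eigenvalues have negative real part. -/
def IsHurwitz {d : ℕ} (A : Matrix (Fin d) (Fin d) ℝ) : Prop :=
  ∀ μ : ℂ, Module.End.HasEigenvalue (Matrix.toLin' (A.map (algebraMap ℝ ℂ))) μ → μ.re < 0

/-- The σ-algebra `σ(x₀, …, x_k)` generated by the first `k + 1` iterates. -/
abbrev history {Ω E : Type*} [MeasurableSpace E] (x : ℕ → Ω → E) (k : ℕ) : MeasurableSpace Ω :=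
  ⨆ j : Fin (k + 1), MeasurableSpace.comap (x j) inferInstance

/-- The history is a genuine sub-σ-algebra, so that conditional expectations given it are not
junk values. -/
theorem history_le {Ω E : Type*} [mΩ : MeasurableSpace Ω] [MeasurableSpace E]
    {x : ℕ → Ω → E} (hx : ∀ k, Measurable (x k)) (k : ℕ) : history x k ≤ mΩ :=
  iSup_le fun j => (hx j).comap_le

/-- The iterates `x` and the noise `w` are random vectors of `ℝᵈ` (with its Euclidean norm)
satisfying the linear stochastic approximation recursion
`x_{k+1} = x_k + a_k (A x_k + b + w_k)`, with an arbitrary random initial vector `x₀`. -/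
structure IsLinearSA {d : ℕ} {Ω : Type*} [MeasurableSpace Ω]
    (A : Matrix (Fin d) (Fin d) ℝ) (b : EuclideanSpace ℝ (Fin d)) (a : ℕ → ℝ)
    (x w : ℕ → Ω → EuclideanSpace ℝ (Fin d)) : Prop where
  measurable_iterate : ∀ k, Measurable (x k)
  measurable_noise : ∀ k, Measurable (w k)
  recursion : ∀ k ω, x (k + 1) ω = x k ω + a k • (A.toEuclideanLin (x k ω) + b + w k ω)

/-- Unbiased noise: `w_k` is integrable and `𝔼[w_k | σ(x₀, …, x_k)] = 0` almost surely. -/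
def IsUnbiasedNoise {d : ℕ} {Ω : Type*} [MeasurableSpace Ω] (P : Measure Ω)
    (x w : ℕ → Ω → EuclideanSpace ℝ (Fin d)) : Prop :=
  ∀ k, Integrable (w k) P ∧ P[w k | history x k] =ᵐ[P] 0

/-- The `p`-th moment growth condition: for some constants `Aₚ > 0`, `Bₚ ≥ 0` and all `k`,
`𝔼[‖w_k‖ᵖ | σ(x₀, …, x_k)] ≤ Aₚ + Bₚ ‖x_k - x⋆‖ᵖ` almost surely. The conditional expectation is
that of a nonnegative random variable, with values in `[0, ∞]`; no integrability of `‖w_k‖ᵖ` is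
required. -/
def HasNoiseMomentGrowth {d : ℕ} {Ω : Type*} [MeasurableSpace Ω] (P : Measure Ω) (p : ℝ)
    (xstar : EuclideanSpace ℝ (Fin d)) (x w : ℕ → Ω → EuclideanSpace ℝ (Fin d)) : Prop :=
  ∃ Ap Bp : ℝ, 0 < Ap ∧ 0 ≤ Bp ∧ ∀ k, ∀ᵐ ω ∂P,
    condLExp (history x k) P (fun ω' => ENNReal.ofReal (‖w k ω'‖ ^ p)) ω
      ≤ ENNReal.ofReal (Ap + Bp * ‖x k ω - xstar‖ ^ p)

/-! Sufficiency is a Lyapunov argument. For some small `h > 0` the spectrum of `M = 1 + h A` lies in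
the open unit disc, so some power `M ^ n` has norm at most `1 / 2`, and `T x = (x, M x, …, M ^ (n -
1) x)` makes `M` a strict contraction for `‖T x‖` (`exists_contracting_embedding`). By convexity `1
+ a A` then contracts `‖T x‖` by a factor `1 - c a` for all `0 < a ≤ h`.

The Lyapunov function is `‖T (x_k - x⋆)‖ ^ (2 (κ + 1))` with `κ ≥ p`. The high power is needed for
`p > 2`: then `∑ a_k ^ 2` may diverge while only `∑ a_k ^ p` is known to converge, and a high power
lets the contraction absorb the second order terms up to `O(a_k ^ p)` (`exists_drift_bound`). Since
the noise has only `p`-th moments, this power need not be integrable. The process is therefore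
killed at the first step with `a_k ‖w_k‖ > 1 + ‖x_k - x⋆‖`. Such a step has probability `O(a_k ^
p)`, so by Borel–Cantelli almost surely only finitely many occur. The killed process contracts in
mean up to `O(a_k ^ p)` (`exists_one_step_bound`), and since `∑ a_k = ∞` a Robbins–Siegmund argument
(`ae_tendsto_zero_of_setIntegral_succ_le`) sends it to zero. Restarting at all late times, with all
integer bounds on the restart point, covers almost every path.

Necessity uses independent symmetric noise started at `x⋆`. If `ξ ≤ 1 / p`, then `∑ a_k ^ p = ∞`,
and noise of size `1 / a_k` with probability `a_k ^ p` (when `a_k ≤ 1`) moves the iterate by a fixed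
amount infinitely often. If `ξ > 1`, then `∑ a_k < ∞`, and after a single late kick the remaining
steps are too small to undo it. -/

/-! ### Hurwitz matrices: powers of `1 + h A` and the equilibrium. -/

open scoped Matrix.Norms.Operator in
/-- The powers of a complex matrix whose spectrum lies in the open unit disc tend to zero. -/
theorem tendsto_matrix_pow_of_spectrum_lt_one {d : ℕ} (hd : 0 < d)
    (M : Matrix (Fin d) (Fin d) ℂ) (hM : ∀ z ∈ spectrum ℂ M, ‖z‖ < 1) :
    Tendsto (fun n : ℕ => M ^ n) atTop (𝓝 0) := by
  have : Nonempty (Fin d) := ⟨⟨0, hd⟩⟩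
  have : CompleteSpace (Matrix (Fin d) (Fin d) ℂ) := FiniteDimensional.complete ℂ _
  have hr : spectralRadius ℂ M < (1 : NNReal) :=
    spectrum.spectralRadius_lt_of_forall_lt M (r := 1) fun z hz => by exact_mod_cast hM z hz
  obtain ⟨r, hr1, hr2⟩ := ENNReal.lt_iff_exists_nnreal_btwn.1 hr
  -- Gelfand's formula: `‖M ^ n‖ ^ (1 / n)` eventually falls below `r < 1`.
  have hg := spectrum.pow_nnnorm_pow_one_div_tendsto_nhds_spectralRadius M
  have hev : ∀ᶠ n : ℕ in atTop, ‖M ^ n‖ ≤ (r : ℝ) ^ n := by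
    filter_upwards [hg.eventually_lt_const hr1, eventually_gt_atTop 0] with n hn hn0
    have h1 : (‖M ^ n‖₊ : ENNReal) ≤ (r : ENNReal) ^ n := by
      have h2 := ENNReal.rpow_le_rpow hn.le (Nat.cast_nonneg n)
      rwa [← ENNReal.rpow_mul, one_div, inv_mul_cancel₀ (by positivity), ENNReal.rpow_one,
        ENNReal.rpow_natCast] at h2
    exact_mod_cast h1
  refine squeeze_zero_norm' hev (tendsto_pow_atTop_nhds_zero_of_lt_one r.2 ?_)
  exact_mod_cast hr2

/-- Eigenvalues of a Hurwitz matrix, as elements of its complex spectrum. -/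
theorem IsHurwitz.re_neg_of_mem_spectrum {d : ℕ} {A : Matrix (Fin d) (Fin d) ℝ} (hA : IsHurwitz A)
    {μ : ℂ} (hμ : μ ∈ spectrum ℂ (A.map (algebraMap ℝ ℂ))) : μ.re < 0 := by
  refine hA μ ?_
  rw [Module.End.hasEigenvalue_iff_mem_spectrum, Matrix.spectrum_toLin']
  exact hμ

/-- Since `|1 + h μ| ^ 2 = 1 + h (2 Re μ + h |μ| ^ 2)`, each eigenvalue of negative real part is
moved into the unit disc by every small `h > 0`; there are finitely many eigenvalues, so one `h`
serves them all. -/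
theorem IsHurwitz.exists_step_spectrum {d : ℕ} {A : Matrix (Fin d) (Fin d) ℝ} (hA : IsHurwitz A) :
    ∃ h : ℝ, 0 < h ∧ ∀ z ∈ spectrum ℂ ((1 + h • A).map (algebraMap ℝ ℂ)), ‖z‖ < 1 := by
  set B := A.map (algebraMap ℝ ℂ) with hB
  have hfin : (spectrum ℂ B).Finite := by
    rw [← Matrix.spectrum_toLin']
    exact Module.End.finite_spectrum _
  have hev : ∀ᶠ h : ℝ in 𝓝[>] 0, ∀ μ ∈ spectrum ℂ B, ‖1 + (h : ℂ) * μ‖ < 1 := by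
    rw [Set.Finite.eventually_all hfin]
    intro μ hμ
    have hre := hA.re_neg_of_mem_spectrum hμ
    have h0 : Tendsto (fun h : ℝ => 2 * μ.re + h * Complex.normSq μ) (𝓝[>] 0)
        (𝓝 (2 * μ.re + 0 * Complex.normSq μ)) :=
      (Continuous.tendsto (by fun_prop) 0).mono_left nhdsWithin_le_nhds
    have h1 : ∀ᶠ h : ℝ in 𝓝[>] 0, 2 * μ.re + h * Complex.normSq μ < 0 :=
      h0.eventually_lt_const (by linarith)
    filter_upwards [h1, self_mem_nhdsWithin] with h hh hpos
    have hpos' : 0 < h := hpos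
    have hsq : ‖1 + (h : ℂ) * μ‖ ^ 2 < 1 := by
      rw [← Complex.normSq_eq_norm_sq, Complex.normSq_apply]
      rw [Complex.normSq_apply] at hh
      simp only [Complex.add_re, Complex.one_re, Complex.mul_re, Complex.ofReal_re,
        Complex.ofReal_im, Complex.add_im, Complex.one_im, Complex.mul_im]
      nlinarith
    nlinarith [norm_nonneg (1 + (h : ℂ) * μ)]
  obtain ⟨h, hh, hpos⟩ := (hev.and self_mem_nhdsWithin).exists
  refine ⟨h, hpos, fun z hz => ?_⟩
  have hpos' : 0 < h := hpos
  have hne : (h : ℂ) ≠ 0 := by exact_mod_cast hpos'.ne'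
  have hmap : (1 + h • A).map (algebraMap ℝ ℂ) = algebraMap ℂ _ 1 + (h : ℂ) • B := by
    ext i j
    by_cases hij : i = j <;>
      simp [hB, Matrix.one_apply, Matrix.algebraMap_matrix_apply, hij]
  rw [hmap] at hz
  have hz1 : (z - 1) ∈ spectrum ℂ ((h : ℂ) • B) := by
    rw [← spectrum.add_mem_add_iff (s := (1 : ℂ))] 
    convert hz using 1
    ring
  have hz2 : (z - 1) / h ∈ spectrum ℂ B := by
    have := (spectrum.smul_mem_smul_iff (a := B) (s := (z - 1) / (h : ℂ)) (r := Units.mk0 (h : ℂ) hne)).1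
    have e : Units.mk0 (h : ℂ) hne • ((z - 1) / (h : ℂ)) = z - 1 := mul_div_cancel₀ _ hne
    rw [e] at this
    exact this hz1
  have := hh _ hz2
  rwa [mul_div_cancel₀ _ hne, add_sub_cancel] at this

/-- The complexified powers tend to zero, and entrywise real parts recover the real powers. In
finite dimension the convergence passes to the Euclidean operator norm. -/
theorem IsHurwitz.exists_pow_norm_lt {d : ℕ} (hd : 0 < d) {A : Matrix (Fin d) (Fin d) ℝ}
    (hA : IsHurwitz A) :
    ∃ h : ℝ, 0 < h ∧ ∃ n : ℕ,
      ‖(1 + h • Matrix.toEuclideanCLM (n := Fin d) (𝕜 := ℝ) A) ^ n‖ ≤ 1 / 2 := by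
  obtain ⟨h, hpos, hsp⟩ := hA.exists_step_spectrum
  refine ⟨h, hpos, ?_⟩
  set M := 1 + h • A with hM
  have hc := tendsto_matrix_pow_of_spectrum_lt_one hd _ hsp
  have hr : Tendsto (fun n : ℕ => M ^ n) atTop (𝓝 0) := by
    have hre : Continuous fun N : Matrix (Fin d) (Fin d) ℂ => N.map Complex.re :=
      Continuous.matrix_map continuous_id Complex.continuous_re
    have h2 := (hre.tendsto 0).comp hc
    convert h2 using 1
    · ext n i j
      have : (M.map (algebraMap ℝ ℂ)) ^ n = (M ^ n).map (algebraMap ℝ ℂ) :=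
        (map_pow ((algebraMap ℝ ℂ).mapMatrix) M n).symm
      rw [Function.comp_apply, this]
      simp
    · simp
  have hcont : Continuous fun N : Matrix (Fin d) (Fin d) ℝ =>
      Matrix.toEuclideanCLM (n := Fin d) (𝕜 := ℝ) N :=
    LinearMap.continuous_of_finiteDimensional
      ((Matrix.toEuclideanCLM (n := Fin d) (𝕜 := ℝ)).toAlgEquiv.toLinearMap)
  have h3 := ((hcont.tendsto 0).comp hr).norm
  simp only [map_zero, norm_zero] at h3
  obtain ⟨n, hn⟩ := (h3.eventually_le_const (show (0 : ℝ) < 1 / 2 by norm_num)).exists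
  refine ⟨n, ?_⟩
  simpa [hM] using hn

/-- Vanishing of `A z + b` at exactly one point, for Hurwitz `A`. -/
theorem IsHurwitz.existsUnique_zero {d : ℕ} {A : Matrix (Fin d) (Fin d) ℝ} (hA : IsHurwitz A)
    (b : EuclideanSpace ℝ (Fin d)) :
    ∃ xstar : EuclideanSpace ℝ (Fin d), ∀ z, A.toEuclideanLin z + b = 0 ↔ z = xstar := by
  have hinj : Function.Injective A.toEuclideanLin := by
    rw [injective_iff_map_eq_zero]
    intro z hz
    by_contra hne
    -- A nonzero real kernel vector, read over `ℂ`, would give the eigenvalue `0`, whose real part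
    -- is not negative.
    have hev : Module.End.HasEigenvalue (Matrix.toLin' (A.map (algebraMap ℝ ℂ))) 0 := by
      refine Module.End.hasEigenvalue_of_hasEigenvector (x := fun i => ((z i : ℝ) : ℂ)) ⟨?_, ?_⟩
      · rw [Module.End.mem_eigenspace_iff]
        ext i
        have hi := congrFun (congrArg WithLp.ofLp hz) i
        simp only [Matrix.ofLp_toLpLin, Matrix.toLin'_apply, Matrix.mulVec, dotProduct] at hi
        simp only [Matrix.toLin'_apply, Matrix.mulVec, dotProduct, Matrix.map_apply, zero_smul,
          Pi.zero_apply, Complex.coe_algebraMap]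
        exact_mod_cast hi
      · intro h0
        apply hne
        ext i
        simpa using congrFun h0 i
    simpa using hA 0 hev
  have hbij : Function.Bijective A.toEuclideanLin :=
    ⟨hinj, LinearMap.injective_iff_surjective.1 hinj⟩
  obtain ⟨y, hy⟩ := hbij.2 (-b)
  refine ⟨y, fun z => ?_⟩
  rw [add_eq_zero_iff_eq_neg, ← hy, hinj.eq_iff]

/-! ### A Lyapunov norm adapted to the drift. -/

/-- If some power of `M` has norm at most `1 / 2`, then `M` is a strict contraction for an
equivalent Euclidean norm, realised by an embedding `T` into an inner product space. -/
theorem exists_contracting_embedding {E : Type*} [NormedAddCommGroup E] [InnerProductSpace ℝ E]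
    (M : E →L[ℝ] E) (n : ℕ) (hn : ‖M ^ n‖ ≤ 1 / 2) :
    ∃ (m : ℕ) (T : E →L[ℝ] PiLp 2 (fun _ : Fin m => E)) (ρ : ℝ), 0 ≤ ρ ∧ ρ < 1 ∧
      (∀ x, ‖x‖ ≤ ‖T x‖) ∧ ∀ x, ‖T (M x)‖ ≤ ρ * ‖T x‖ := by
  let T : E →L[ℝ] PiLp 2 (fun _ : Fin n => E) :=
    (PiLp.continuousLinearEquiv 2 ℝ (fun _ : Fin n => E)).symm.toContinuousLinearMap ∘L
      ContinuousLinearMap.pi fun j : Fin n => M ^ (j : ℕ)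
  have hT : ∀ x, ‖T x‖ ^ 2 = ∑ j ∈ Finset.range n, ‖(M ^ j) x‖ ^ 2 := by
    intro x
    rw [PiLp.norm_sq_eq_of_L2, Finset.sum_range]
    rfl
  have hMn : ∀ x, ‖(M ^ n) x‖ ≤ 1 / 2 * ‖x‖ := fun x =>
    (ContinuousLinearMap.le_opNorm _ x).trans (by gcongr)
  -- Replacing `x` by `M x` shifts the sum: it loses `‖x‖ ^ 2` and gains `‖(M ^ n) x‖ ^ 2 ≤ ‖x‖ ^ 2
  -- / 4`.
  have hdrift : ∀ x, ‖T (M x)‖ ^ 2 ≤ ‖T x‖ ^ 2 - 3 / 4 * ‖x‖ ^ 2 := by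
    intro x
    have h1 : ∀ j, (M ^ j) (M x) = (M ^ (j + 1)) x := fun j => by rw [pow_succ]; rfl
    have h2 := Finset.sum_range_succ (fun j => ‖(M ^ j) x‖ ^ 2) n
    rw [Finset.sum_range_succ'] at h2
    simp only [pow_zero, one_apply_eq_self] at h2
    rw [hT, hT]
    simp only [h1]
    have h3 := hMn x
    nlinarith [norm_nonneg ((M ^ n) x), norm_nonneg x]
  have hlow : ∀ x, ‖x‖ ≤ ‖T x‖ := by
    intro x
    -- For `n = 0` the target of `T` is trivial, but then `hMn` reads `‖x‖ ≤ ‖x‖ / 2` and forces `x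
    -- = 0`.
    rcases Nat.eq_zero_or_pos n with rfl | hn0
    · have := hMn x
      simp only [pow_zero, one_apply_eq_self] at this
      linarith [norm_nonneg (T x), norm_nonneg x]
    · have h1 := Finset.single_le_sum (f := fun j => ‖(M ^ j) x‖ ^ 2)
        (fun j _ => by positivity) (Finset.mem_range.2 hn0)
      simp only [← hT, pow_zero, one_apply_eq_self] at h1
      exact le_of_sq_le_sq h1 (norm_nonneg _)
  -- From `‖T x‖ ^ 2 ≤ D ‖x‖ ^ 2` the loss `3 / 4 * ‖x‖ ^ 2` becomes a proportion of `‖T x‖ ^ 2`; `D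
  -- ≥ 1` keeps the radicand below nonnegative.
  set D : ℝ := ‖T‖ ^ 2 + 1 with hD
  have hD1 : 1 ≤ D := by rw [hD]; nlinarith [sq_nonneg ‖T‖]
  have hq : 0 ≤ 1 - 3 / (4 * D) := by
    rw [sub_nonneg, div_le_one (by positivity)]
    linarith
  refine ⟨n, T, √(1 - 3 / (4 * D)), Real.sqrt_nonneg _, ?_, hlow, fun x => ?_⟩
  · rw [Real.sqrt_lt' one_pos]
    have : 0 < 3 / (4 * D) := by positivity
    linarith
  · refine le_of_sq_le_sq ?_ (by positivity)
    rw [mul_pow, Real.sq_sqrt hq]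
    refine (hdrift x).trans ?_
    have h1 : ‖T x‖ ^ 2 ≤ D * ‖x‖ ^ 2 := by
      have h2 := T.le_opNorm x
      have h3 : ‖T x‖ ^ 2 ≤ (‖T‖ * ‖x‖) ^ 2 := by gcongr
      rw [hD]
      nlinarith [sq_nonneg ‖x‖]
    have h2 : 3 / (4 * D) * ‖T x‖ ^ 2 ≤ 3 / 4 * ‖x‖ ^ 2 := by
      calc 3 / (4 * D) * ‖T x‖ ^ 2 ≤ 3 / (4 * D) * (D * ‖x‖ ^ 2) := by gcongr
        _ = 3 / 4 * ‖x‖ ^ 2 := by field_simp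
    linarith

/-! ### Deterministic inequalities for powers of the norm. -/

/-- Second order expansion of even powers of the norm, with a remainder of degree at least two
in the increment. -/
theorem exists_norm_add_pow_le (F : Type*) [NormedAddCommGroup F] [InnerProductSpace ℝ F] (k : ℕ) :
    ∃ C : ℝ, 0 ≤ C ∧ ∀ y z : F, ‖y + z‖ ^ (2 * (k + 1)) ≤ ‖y‖ ^ (2 * (k + 1)) +
      2 * (k + 1) * ‖y‖ ^ (2 * k) * inner ℝ y z +
      C * (‖y‖ ^ (2 * k) * ‖z‖ ^ 2 + ‖z‖ ^ (2 * (k + 1))) := by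
  induction k with
  | zero =>
    refine ⟨1, zero_le_one, fun y z => ?_⟩
    have := norm_add_sq_real y z
    simp only [zero_add, mul_one, Nat.cast_zero, mul_zero, pow_zero]
    nlinarith [sq_nonneg ‖z‖]
  | succ k ih =>
    obtain ⟨C, hC, h⟩ := ih
    refine ⟨1 + 6 * (k + 1) + 6 * C, by positivity, fun y z => ?_⟩
    have h1 := h y z
    have h2 := norm_add_sq_real y z
    have hi := abs_le.1 (abs_real_inner_le_norm y z)
    simp only [pow_mul, pow_succ _ (k + 1), pow_succ _ k] at h1 ⊢
    push_cast
    set i := inner ℝ y z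
    have hu := norm_nonneg y
    have hr := norm_nonneg z
    have hiU : i ^ 2 ≤ ‖y‖ ^ 2 * ‖z‖ ^ 2 := by nlinarith
    have hiR : 2 * i ≤ ‖y‖ ^ 2 + ‖z‖ ^ 2 := by nlinarith [sq_nonneg (‖y‖ - ‖z‖)]
    have hU : 0 ≤ ‖y‖ ^ 2 := by positivity
    have hR : 0 ≤ ‖z‖ ^ 2 := by positivity
    have hN : 0 ≤ ‖y + z‖ ^ 2 := by positivity
    have hP : 0 ≤ (‖y‖ ^ 2) ^ k := by positivity
    have hQ : 0 ≤ (‖z‖ ^ 2) ^ k := by positivity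
    have hPQ : ‖y‖ ^ 2 ≤ ‖z‖ ^ 2 → (‖y‖ ^ 2) ^ k ≤ (‖z‖ ^ 2) ^ k := fun h =>
      pow_le_pow_left₀ hU h k
    have hQP : ‖z‖ ^ 2 ≤ ‖y‖ ^ 2 → (‖z‖ ^ 2) ^ k ≤ (‖y‖ ^ 2) ^ k := fun h =>
      pow_le_pow_left₀ hR h k
    generalize ‖y + z‖ ^ 2 = N at *
    generalize ‖y‖ ^ 2 = U at *
    generalize ‖z‖ ^ 2 = R at *
    generalize U ^ k = p at *
    generalize R ^ k = q at *
    subst h2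
    -- After multiplication by `‖y + z‖ ^ 2 = U + 2 i + R`, the remainder may contain only `X` and
    -- `Y`; mixed terms are absorbed according to which of `U`, `R` is larger.
    set X := p * U * R with hX
    set Y := q * R * R with hY
    have e1 : p * R * R ≤ X + Y := by
      rcases le_total U R with hle | hle
      · have := mul_le_mul_of_nonneg_right (hPQ hle) (mul_nonneg hR hR)
        nlinarith [mul_nonneg (mul_nonneg hP hU) hR]
      · have := mul_le_mul_of_nonneg_left hle (mul_nonneg hP hR)
        nlinarith [mul_nonneg (mul_nonneg hQ hR) hR]
    have e2 : q * R * U ≤ X + Y := by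
      rcases le_total U R with hle | hle
      · have := mul_le_mul_of_nonneg_left hle (mul_nonneg hQ hR)
        nlinarith [mul_nonneg (mul_nonneg hP hU) hR]
      · have := mul_le_mul_of_nonneg_right (hQP hle) (mul_nonneg hR hU)
        nlinarith [mul_nonneg (mul_nonneg hQ hR) hR]
    have hXn : 0 ≤ X := by positivity
    have hYn : 0 ≤ Y := by positivity
    have e3 : p * (2 * i ^ 2 + i * R) ≤ 3 * (X + Y) := by
      have t1 : p * i ^ 2 ≤ p * (U * R) := mul_le_mul_of_nonneg_left hiU hP
      have t2 : (p * R) * (2 * i) ≤ (p * R) * (U + R) :=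
        mul_le_mul_of_nonneg_left hiR (mul_nonneg hP hR)
      nlinarith
    have e4 : (p * R + q * R) * (U + 2 * i + R) ≤ 6 * (X + Y) := by
      have t1 : (p * R + q * R) * (2 * i) ≤ (p * R + q * R) * (U + R) :=
        mul_le_mul_of_nonneg_left hiR (by positivity)
      nlinarith
    have e5 := mul_le_mul_of_nonneg_left e4 hC
    have e6 := mul_le_mul_of_nonneg_left e3 (show (0 : ℝ) ≤ 2 * (k + 1) by positivity)
    have e7 := mul_le_mul_of_nonneg_right h1 hN
    refine e7.trans ?_
    have e8 : X ≤ 1 * (X + Y) := by linarith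
    calc _ = p * U * U + 2 * ((k : ℝ) + 1 + 1) * (p * U) * i + X
          + 2 * (k + 1) * (p * (2 * i ^ 2 + i * R))
          + C * ((p * R + q * R) * (U + 2 * i + R)) := by rw [hX]; ring
      _ ≤ _ := by
        rw [show p * U * R + q * R * R = X + Y from rfl]
        linarith

/-- Expansion of an even power of the norm under a truncated increment: the part of the increment
where the truncation acts is controlled by the `p`-th power of its relative size. -/
theorem exists_truncated_norm_add_pow_le (F : Type*) [NormedAddCommGroup F]
    [InnerProductSpace ℝ F] (k : ℕ) {p c : ℝ} (hp : 1 < p) (hpk : p ≤ 2 * (k + 1)) (hc : 0 ≤ c) :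
    ∃ C : ℝ, 0 ≤ C ∧ ∀ (y z : F) (s r a : ℝ), 0 < s → 0 ≤ r → 0 < a → ‖z‖ ≤ c * r → ‖y‖ ≤ c * s →
      (if r ≤ s then ‖y + z‖ ^ (2 * (k + 1)) else 0) ≤ ‖y‖ ^ (2 * (k + 1)) +
      2 * (k + 1) * ‖y‖ ^ (2 * k) * inner ℝ y z +
      C * (a ^ 2 * (‖y‖ ^ (2 * k) * s ^ 2) +
        (r / s) ^ p * (s ^ (2 * (k + 1)) + a ^ (2 - p) * (‖y‖ ^ (2 * k) * s ^ 2))) := by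
  obtain ⟨C, hC, h⟩ := exists_norm_add_pow_le F k
  refine ⟨C * (2 * c ^ (2 * k + 2) + c ^ 2) + 2 * (k + 1) * c ^ (2 * k + 2), by positivity,
    fun y z s r a hs hr ha hz hy => ?_⟩
  -- `θ` is the relative size of the increment; truncation acts exactly when `θ > 1`.
  obtain ⟨θ, rfl⟩ : ∃ θ, r = s * θ := ⟨r / s, by field_simp⟩
  have hθ : 0 ≤ θ := by
    by_contra hneg
    nlinarith
  rw [mul_div_cancel_left₀ _ hs.ne']
  have hθp : 0 ≤ θ ^ p := Real.rpow_nonneg hθ p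
  have hap : 0 ≤ a ^ (2 - p) := Real.rpow_nonneg ha.le _
  have hPc : ‖y‖ ^ (2 * k) * s ^ 2 * c ^ 2 ≤ c ^ (2 * k + 2) * s ^ (2 * (k + 1)) := by
    have : ‖y‖ ^ (2 * k) ≤ (c * s) ^ (2 * k) := by gcongr
    calc ‖y‖ ^ (2 * k) * s ^ 2 * c ^ 2 ≤ (c * s) ^ (2 * k) * s ^ 2 * c ^ 2 := by gcongr
      _ = _ := by ring
  have hP : 0 ≤ ‖y‖ ^ (2 * k) := by positivity
  have hS : 0 ≤ s ^ (2 * (k + 1)) := by positivity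
  split_ifs with hrs
  · have hθ1 : θ ≤ 1 := by
      by_contra hneg
      nlinarith
    refine (h y z).trans ?_
    -- For `p ≤ 2`, `θ ≤ 1` gives `θ ^ 2 ≤ θ ^ p`. For `p ≥ 2`, either `θ ≤ a`, or `θ ^ (2 - p) ≤ a
    -- ^ (2 - p)`. The weight `a ^ (2 - p)` is chosen so that a mean of `θ ^ p` of order `a ^ p`
    -- contributes order `a ^ 2`.
    have h1 : θ ^ 2 ≤ a ^ 2 + θ ^ p + a ^ (2 - p) * θ ^ p := by
      rcases hθ.eq_or_lt with rfl | hθpos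
      · rw [zero_pow two_ne_zero]
        positivity
      rcases le_total p 2 with hp2 | hp2
      · have : θ ^ (2 : ℝ) ≤ θ ^ p := Real.rpow_le_rpow_of_exponent_ge hθpos hθ1 hp2
        rw [Real.rpow_two] at this
        nlinarith [mul_nonneg hap hθp, sq_nonneg a]
      · rcases le_total θ a with hle | hle
        · nlinarith [mul_nonneg hap hθp]
        · have : θ ^ (2 - p) ≤ a ^ (2 - p) :=
            Real.rpow_le_rpow_of_nonpos ha hle (by linarith)
          have e : θ ^ 2 = θ ^ (2 - p) * θ ^ p := by
            rw [← Real.rpow_add hθpos, sub_add_cancel, Real.rpow_two]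
          rw [e]
          nlinarith [sq_nonneg a]
    have h2 : ‖z‖ ^ (2 * (k + 1)) ≤ c ^ (2 * k + 2) * s ^ (2 * (k + 1)) * θ ^ p := by
      have e1 : ‖z‖ ^ (2 * (k + 1)) ≤ (c * (s * θ)) ^ (2 * (k + 1)) := by gcongr
      have e2 : θ ^ (2 * (k + 1)) ≤ θ ^ p := by
        rcases hθ.eq_or_lt with rfl | hθpos
        · rw [zero_pow (by omega)]
          positivity
        rw [← Real.rpow_natCast]
        refine Real.rpow_le_rpow_of_exponent_ge hθpos hθ1 ?_
        push_cast
        linarith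
      calc _ ≤ _ := e1
        _ = c ^ (2 * k + 2) * s ^ (2 * (k + 1)) * θ ^ (2 * (k + 1)) := by ring
        _ ≤ _ := by gcongr
    have h3 : ‖y‖ ^ (2 * k) * ‖z‖ ^ 2 ≤ c ^ 2 * (a ^ 2 * (‖y‖ ^ (2 * k) * s ^ 2) +
        θ ^ p * (a ^ (2 - p) * (‖y‖ ^ (2 * k) * s ^ 2))) +
        c ^ (2 * k + 2) * s ^ (2 * (k + 1)) * θ ^ p := by
      calc ‖y‖ ^ (2 * k) * ‖z‖ ^ 2 ≤ ‖y‖ ^ (2 * k) * (c * (s * θ)) ^ 2 := by gcongr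
        _ = ‖y‖ ^ (2 * k) * s ^ 2 * c ^ 2 * θ ^ 2 := by ring
        _ ≤ ‖y‖ ^ (2 * k) * s ^ 2 * c ^ 2 * (a ^ 2 + θ ^ p + a ^ (2 - p) * θ ^ p) := by gcongr
        _ ≤ _ := by nlinarith [mul_le_mul_of_nonneg_right hPc hθp]
    set X := a ^ 2 * (‖y‖ ^ (2 * k) * s ^ 2)
    set W := a ^ (2 - p) * (‖y‖ ^ (2 * k) * s ^ 2)
    have hX : 0 ≤ X := by positivity
    have hW : 0 ≤ W := by positivity
    have hSθ : 0 ≤ θ ^ p * s ^ (2 * (k + 1)) := by positivity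
    have hWθ : 0 ≤ θ ^ p * W := by positivity
    have hck : 0 ≤ c ^ (2 * k + 2) := by positivity
    have h4 : ‖y‖ ^ (2 * k) * ‖z‖ ^ 2 + ‖z‖ ^ (2 * (k + 1)) ≤
        (2 * c ^ (2 * k + 2) + c ^ 2) * (X + θ ^ p * (s ^ (2 * (k + 1)) + W)) := by
      nlinarith [mul_nonneg hck hX, mul_nonneg hck hWθ, mul_nonneg (sq_nonneg c) hSθ]
    have h5 := mul_le_mul_of_nonneg_left h4 hC
    have h6 : 0 ≤ 2 * (k + 1) * c ^ (2 * k + 2) * (X + θ ^ p * (s ^ (2 * (k + 1)) + W)) := by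
      positivity
    linarith
  -- The left side is now `0`, but the linear term on the right may be negative; it is at most of
  -- order `θ`, and `θ ≤ θ ^ p`.
  · have hθ1 : 1 < θ := by
      by_contra hneg
      nlinarith
    have hθle : θ ≤ θ ^ p := by
      calc θ = θ ^ (1 : ℝ) := (Real.rpow_one θ).symm
        _ ≤ θ ^ p := Real.rpow_le_rpow_of_exponent_le hθ1.le hp.le
    have h1 : -(‖y‖ ^ (2 * k) * inner ℝ y z) ≤ c ^ (2 * k + 2) * s ^ (2 * (k + 1)) * θ ^ p := by
      have e1 : -inner ℝ y z ≤ (c * s) * (c * (s * θ)) :=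
        (neg_le.1 (abs_le.1 (abs_real_inner_le_norm y z)).1).trans (by gcongr)
      calc -(‖y‖ ^ (2 * k) * inner ℝ y z) = ‖y‖ ^ (2 * k) * -inner ℝ y z := by ring
        _ ≤ ‖y‖ ^ (2 * k) * ((c * s) * (c * (s * θ))) := by gcongr
        _ = ‖y‖ ^ (2 * k) * s ^ 2 * c ^ 2 * θ := by ring
        _ ≤ c ^ (2 * k + 2) * s ^ (2 * (k + 1)) * θ ^ p := by gcongr
    have h2 := mul_le_mul_of_nonneg_left h1 (show (0 : ℝ) ≤ 2 * (k + 1) by positivity)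
    set X := a ^ 2 * (‖y‖ ^ (2 * k) * s ^ 2)
    set W := a ^ (2 - p) * (‖y‖ ^ (2 * k) * s ^ 2)
    have hX : 0 ≤ 2 * (k + 1) * c ^ (2 * k + 2) * X := by positivity
    have hWθ : 0 ≤ 2 * (k + 1) * c ^ (2 * k + 2) * (θ ^ p * W) := by positivity
    have hZ : 0 ≤ C * (2 * c ^ (2 * k + 2) + c ^ 2) *
      (X + θ ^ p * (s ^ (2 * (k + 1)) + W)) := by positivity
    have hy2 : 0 ≤ ‖y‖ ^ (2 * (k + 1)) := by positivity
    linarith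

/-- A contraction by the factor `1 - c a` dominates second order terms of size `a ^ 2` and
`a ^ p`, up to an additive error of order `a ^ p`. -/
theorem exists_drift_bound (k : ℕ) {c K p : ℝ} (hc : 0 < c) (hK : 0 ≤ K) (hp : 1 < p)
    (hpk : p ≤ k + 2) :
    ∃ C : ℝ, 0 ≤ C ∧ ∀ᶠ a : ℝ in 𝓝[>] 0, ∀ u v n : ℝ, 0 ≤ u → 0 ≤ n → u ≤ (1 - c * a) * v → n ≤ v →
      u ^ (2 * (k + 1)) + K * (a ^ 2 * (u ^ (2 * k) * (1 + n) ^ 2) + a ^ p * (1 + n) ^ (2 * (k + 1)))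
        ≤ (1 - c / 2 * a) * v ^ (2 * (k + 1)) + C * a ^ p := by
  -- With this `ε` and small `a`, the second order terms use `c a / 4` (`t7`) and the `a ^ p` terms
  -- `c a / 8` (`t8`) of the gain `c a`, leaving at least half of it.
  set ε : ℝ := c / (16 * (K + 1)) with hε
  have hεpos : 0 < ε := by positivity
  refine ⟨K * (2 * (ε⁻¹) ^ k + 4 ^ (k + 1)), by positivity, ?_⟩
  have hlim : Tendsto (fun a : ℝ => a ^ (p - 1)) (𝓝[>] 0) (𝓝 0) := by
    have := (Real.continuousAt_rpow_const 0 (p - 1) (Or.inr (by linarith))).tendsto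
    rw [Real.zero_rpow (by linarith)] at this
    exact this.mono_left nhdsWithin_le_nhds
  have hid : Tendsto (fun a : ℝ => a) (𝓝[>] 0) (𝓝 0) := tendsto_id.mono_left nhdsWithin_le_nhds
  have hδ : 0 < c / (8 * (K + 1) * 4 ^ (k + 1)) := by positivity
  filter_upwards [hlim.eventually_lt_const hδ, hid.eventually_lt_const hεpos,
    hid.eventually_lt_const one_pos, hid.eventually_lt_const (inv_pos.2 hc), self_mem_nhdsWithin]
    with a h1 h2 h3 h4 ha u v n hu hn huv hnv
  have ha : 0 < a := ha
  have hv : 0 ≤ v := hn.trans hnv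
  have hca : c * a ≤ 1 := by
    have := mul_lt_mul_of_pos_left h4 hc
    rw [mul_inv_cancel₀ hc.ne'] at this
    exact this.le
  have huv' : u ≤ v := huv.trans (by nlinarith [mul_nonneg (mul_pos hc ha).le hv])
  set V := v ^ (2 * (k + 1)) with hV
  have hVn : 0 ≤ V := by positivity
  have hapn : 0 ≤ a ^ p := Real.rpow_nonneg ha.le p
  have t1 : u ^ (2 * (k + 1)) ≤ (1 - c * a) * V := by
    calc u ^ (2 * (k + 1)) ≤ ((1 - c * a) * v) ^ (2 * (k + 1)) := by gcongr
      _ = (1 - c * a) ^ (2 * (k + 1)) * V := by rw [mul_pow]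
      _ ≤ (1 - c * a) * V := by
        gcongr
        exact pow_le_of_le_one (by linarith) (by nlinarith) (by omega)
  -- A Young-type inequality, by comparing `a` with `ε v ^ 2`: the lower power of `v` is traded for
  -- the top power and a pure power of `a`.
  have t2 : a * v ^ (2 * k) ≤ ε * V + (ε⁻¹) ^ k * a ^ (k + 1) := by
    have eV : V = v ^ (2 * k) * v ^ 2 := by rw [hV]; ring
    have hvk : 0 ≤ v ^ (2 * k) := by positivity
    rcases le_total a (ε * v ^ 2) with hle | hle
    · have : a * v ^ (2 * k) ≤ ε * v ^ 2 * v ^ (2 * k) := by gcongr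
      have : 0 ≤ (ε⁻¹) ^ k * a ^ (k + 1) := by positivity
      rw [eV]; linarith
    · have e1 : v ^ 2 ≤ ε⁻¹ * a := by
        rw [inv_mul_eq_div, le_div_iff₀ hεpos]; linarith
      have e2 : v ^ (2 * k) ≤ (ε⁻¹ * a) ^ k := by
        rw [pow_mul]; gcongr
      calc a * v ^ (2 * k) ≤ a * (ε⁻¹ * a) ^ k := by gcongr
        _ = (ε⁻¹) ^ k * a ^ (k + 1) := by ring
        _ ≤ _ := by
          have : 0 ≤ ε * V := by positivity
          linarith
  -- The requirement `p ≤ k + 2` comes from here.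
  have t3 : a * a ^ (k + 1) ≤ a ^ p := by
    rw [← pow_succ', ← Real.rpow_natCast]
    refine Real.rpow_le_rpow_of_exponent_ge ha h3.le ?_
    push_cast
    linarith
  have t4 : a ^ 2 * (u ^ (2 * k) * (1 + n) ^ 2) ≤
      (2 * a ^ 2 + 2 * a * ε) * V + 2 * (ε⁻¹) ^ k * a ^ p := by
    calc a ^ 2 * (u ^ (2 * k) * (1 + n) ^ 2) ≤ a ^ 2 * (v ^ (2 * k) * (2 * (1 + v ^ 2))) := by
          have : (1 + n) ^ 2 ≤ 2 * (1 + v ^ 2) := by nlinarith [sq_nonneg (1 - n)]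
          gcongr
      _ = 2 * a ^ 2 * V + 2 * a * (a * v ^ (2 * k)) := by rw [hV]; ring
      _ ≤ 2 * a ^ 2 * V + 2 * a * (ε * V + (ε⁻¹) ^ k * a ^ (k + 1)) := by gcongr
      _ = (2 * a ^ 2 + 2 * a * ε) * V + 2 * (ε⁻¹) ^ k * (a * a ^ (k + 1)) := by ring
      _ ≤ _ := by gcongr
  have t5 : (1 + n) ^ (2 * (k + 1)) ≤ 4 ^ (k + 1) * (1 + V) := by
    have e4 : ((4 : ℝ)) ^ (k + 1) = 2 ^ (2 * (k + 1)) := by rw [pow_mul]; norm_num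
    rw [e4]
    rcases le_total v 1 with hle | hle
    · calc (1 + n) ^ (2 * (k + 1)) ≤ 2 ^ (2 * (k + 1)) * 1 := by
            rw [mul_one]; gcongr; linarith
        _ ≤ _ := by gcongr; linarith
    · calc (1 + n) ^ (2 * (k + 1)) ≤ (2 * v) ^ (2 * (k + 1)) := by gcongr; linarith
        _ = 2 ^ (2 * (k + 1)) * V := by rw [mul_pow]
        _ ≤ _ := by gcongr; linarith
  have t6 : a ^ p = a * a ^ (p - 1) := by
    rw [← Real.rpow_one_add' ha.le (by linarith)]
    congr 1; ring
  have t7 : K * (2 * a ^ 2 + 2 * a * ε) ≤ c * a / 4 := by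
    have e : ε * (K + 1) = c / 16 := by rw [hε]; field_simp
    have : a ^ 2 ≤ a * ε := by rw [sq]; gcongr
    calc K * (2 * a ^ 2 + 2 * a * ε) ≤ K * (2 * (a * ε) + 2 * a * ε) := by gcongr
      _ ≤ (K + 1) * (4 * (a * ε)) := by
        have := mul_pos ha hεpos
        linarith
      _ = 4 * a * (ε * (K + 1)) := by ring
      _ = c * a / 4 := by rw [e]; ring
  have t8 : K * 4 ^ (k + 1) * a ^ p ≤ c * a / 8 := by
    rw [lt_div_iff₀ (by positivity)] at h1
    have e4 : (0 : ℝ) < 4 ^ (k + 1) := by positivity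
    have e5 : 0 ≤ a ^ (p - 1) := Real.rpow_nonneg ha.le _
    have : K * 4 ^ (k + 1) * a ^ (p - 1) ≤ c / 8 := by
      nlinarith [mul_nonneg e4.le e5]
    calc K * 4 ^ (k + 1) * a ^ p = a * (K * 4 ^ (k + 1) * a ^ (p - 1)) := by rw [t6]; ring
      _ ≤ a * (c / 8) := by gcongr
      _ = c * a / 8 := by ring
  have t4' := mul_le_mul_of_nonneg_left t4 hK
  have t5' := mul_le_mul_of_nonneg_left (mul_le_mul_of_nonneg_left t5 hapn) hK
  have t7' := mul_le_mul_of_nonneg_right t7 hVn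
  have t8' := mul_le_mul_of_nonneg_right t8 hVn
  have t9 : 0 ≤ c * a * V := by positivity
  linarith

/-! ### The mean one-step estimate. -/

/-- A bounded `m`-measurable vector is orthogonal in mean to a linear image of a random vector
whose conditional expectation given `m` vanishes. -/
theorem setIntegral_inner_eq_zero_of_condExp_eq_zero {Ω E F : Type*} {m mΩ : MeasurableSpace Ω}
    [NormedAddCommGroup E] [InnerProductSpace ℝ E] [CompleteSpace E]
    [NormedAddCommGroup F] [InnerProductSpace ℝ F] {P : Measure Ω} [IsProbabilityMeasure P]
    (hm : m ≤ mΩ) (T : E →L[ℝ] F) {w : Ω → E} (hw : Integrable w P) (hw0 : P[w | m] =ᵐ[P] 0)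
    {h : Ω → F} (hh : StronglyMeasurable[m] h) {G : Set Ω} (hG : MeasurableSet[m] G) {R : ℝ}
    (hR : ∀ ω ∈ G, ‖h ω‖ ≤ R) :
    IntegrableOn (fun ω => inner ℝ (h ω) (T (w ω))) G P ∧
      ∫ ω in G, inner ℝ (h ω) (T (w ω)) ∂P = 0 := by
  let B : F →L[ℝ] E →L[ℝ] ℝ :=
    ((isBoundedBilinearMap_inner (𝕜 := ℝ) (E := F)).toContinuousLinearMap).bilinearComp
      (ContinuousLinearMap.id ℝ F) T
  have hB : ∀ u v, B u v = inner ℝ u (T v) := fun u v => rfl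
  -- Cutting `h` off outside `G` makes it bounded everywhere, so the pull-out property of
  -- conditional expectation applies.
  have hind : StronglyMeasurable[m] (G.indicator h) := hh.indicator hG
  have hfeq : (fun ω => B (G.indicator h ω) (w ω)) =
      G.indicator fun ω => inner ℝ (h ω) (T (w ω)) := by
    ext ω
    by_cases hω : ω ∈ G <;> simp [hω, hB]
  have hint : Integrable (fun ω => B (G.indicator h ω) (w ω)) P := by
    refine Integrable.mono' (hw.norm.const_mul (|R| * ‖T‖)) ?_ (ae_of_all _ fun ω => ?_)
    · exact B.aestronglyMeasurable_comp₂ (hind.mono hm).aestronglyMeasurable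
        hw.aestronglyMeasurable
    · rw [hB]
      refine (norm_inner_le_norm _ _).trans ?_
      have h1 : ‖G.indicator h ω‖ ≤ |R| := by
        by_cases hω : ω ∈ G
        · simpa [hω] using (hR ω hω).trans (le_abs_self R)
        · simp [hω]
      calc ‖G.indicator h ω‖ * ‖T (w ω)‖ ≤ |R| * (‖T‖ * ‖w ω‖) := by
            gcongr
            exact T.le_opNorm _
        _ = _ := by ring
  constructor
  · rw [← integrable_indicator_iff (hm _ hG), ← hfeq]
    exact hint
  · rw [← integral_indicator (hm _ hG), ← hfeq, ← integral_condExp hm]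
    have h1 := condExp_bilin_of_stronglyMeasurable_left B hind hint hw
    rw [integral_eq_zero_of_ae]
    filter_upwards [h1, hw0] with ω h2 h3
    rw [h2, h3]
    simp

/-- Weighted conditional moment bound for the relative size of the increment. -/
theorem integral_relative_moment_le {Ω E : Type*} {m mΩ : MeasurableSpace Ω}
    [NormedAddCommGroup E] [MeasurableSpace E] [BorelSpace E]
    {P : Measure Ω} [IsProbabilityMeasure P] (hm : m ≤ mΩ)
    {x w : Ω → E} (hx : Measurable[m] x) (hw : Measurable w) {p C a : ℝ} (hC : 0 ≤ C) (ha : 0 ≤ a)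
    (hmom : ∀ φ : Ω → ENNReal, Measurable[m] φ →
      ∫⁻ ω, φ ω * ENNReal.ofReal (‖w ω‖ ^ p) ∂P ≤
        ∫⁻ ω, φ ω * ENNReal.ofReal (C * (1 + ‖x ω‖) ^ p) ∂P)
    {g : Ω → ℝ} (hg : Measurable[m] g) (hg0 : 0 ≤ g) {R : ℝ} (hR : ∀ ω, g ω ≤ R) :
    Integrable (fun ω => (a * ‖w ω‖ / (1 + ‖x ω‖)) ^ p * g ω) P ∧
      ∫ ω, (a * ‖w ω‖ / (1 + ‖x ω‖)) ^ p * g ω ∂P ≤ C * a ^ p * ∫ ω, g ω ∂P := by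
  have hs : ∀ ω, 0 < 1 + ‖x ω‖ := fun ω => by positivity
  have hsm : Measurable[m] fun ω => (1 + ‖x ω‖) ^ p :=
    ((measurable_norm.comp hx).const_add 1).pow_const p
  have hap : 0 ≤ a ^ p := Real.rpow_nonneg ha p
  -- Dividing by `(1 + ‖x‖) ^ p` cancels the growth of the moment bound, leaving `C a ^ p g`.
  set φ : Ω → ENNReal := fun ω => ENNReal.ofReal (a ^ p / (1 + ‖x ω‖) ^ p * g ω) with hφ
  have hφm : Measurable[m] φ := by
    refine ENNReal.measurable_ofReal.comp ?_
    exact (measurable_const.div hsm).mul hg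
  have hgi : Integrable g P :=
    Integrable.of_bound (hg.mono hm le_rfl).aestronglyMeasurable R
      (ae_of_all _ fun ω => by rw [Real.norm_of_nonneg (hg0 ω)]; exact hR ω)
  have hnn : ∀ ω, 0 ≤ (a * ‖w ω‖ / (1 + ‖x ω‖)) ^ p * g ω := fun ω =>
    mul_nonneg (Real.rpow_nonneg (by have := hs ω; positivity) _) (hg0 ω)
  have e1 : ∀ ω, ENNReal.ofReal ((a * ‖w ω‖ / (1 + ‖x ω‖)) ^ p * g ω) =
      φ ω * ENNReal.ofReal (‖w ω‖ ^ p) := by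
    intro ω
    rw [hφ]
    simp only
    rw [← ENNReal.ofReal_mul (mul_nonneg (div_nonneg hap (Real.rpow_nonneg (hs ω).le _)) (hg0 ω)),
      Real.div_rpow (by positivity) (hs ω).le, Real.mul_rpow ha (norm_nonneg _)]
    congr 1
    ring
  have e2 : ∀ ω, φ ω * ENNReal.ofReal (C * (1 + ‖x ω‖) ^ p) =
      ENNReal.ofReal (C * a ^ p * g ω) := by
    intro ω
    have hsp : (1 + ‖x ω‖) ^ p ≠ 0 := (Real.rpow_pos_of_pos (hs ω) p).ne'
    rw [hφ]
    simp only
    rw [← ENNReal.ofReal_mul (mul_nonneg (div_nonneg hap (Real.rpow_nonneg (hs ω).le _)) (hg0 ω))]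
    congr 1
    field_simp
  have hle : ∫⁻ ω, ENNReal.ofReal ((a * ‖w ω‖ / (1 + ‖x ω‖)) ^ p * g ω) ∂P ≤
      ENNReal.ofReal (C * a ^ p * ∫ ω, g ω ∂P) := by
    have := hmom φ hφm
    simp only [← e1, e2] at this
    refine this.trans_eq ?_
    rw [← integral_const_mul, ofReal_integral_eq_lintegral_ofReal (hgi.const_mul _)]
    exact ae_of_all _ fun ω => mul_nonneg (mul_nonneg hC hap) (hg0 ω)
  have hmeas : Measurable fun ω => (a * ‖w ω‖ / (1 + ‖x ω‖)) ^ p * g ω := by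
    have hx' := hx.mono hm le_rfl
    have hg' := hg.mono hm le_rfl
    fun_prop
  have hi : Integrable (fun ω => (a * ‖w ω‖ / (1 + ‖x ω‖)) ^ p * g ω) P := by
    refine ⟨hmeas.aestronglyMeasurable, ?_⟩
    rw [hasFiniteIntegral_iff_ofReal (ae_of_all _ hnn)]
    exact hle.trans_lt ENNReal.ofReal_lt_top
  refine ⟨hi, ?_⟩
  rw [← ofReal_integral_eq_lintegral_ofReal hi (ae_of_all _ hnn)] at hle
  exact (ENNReal.ofReal_le_ofReal_iff (mul_nonneg (mul_nonneg hC hap)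
    (integral_nonneg hg0))).1 hle

theorem integral_add_four_mul {Ω : Type*} {mΩ : MeasurableSpace Ω} {μ : Measure Ω}
    {f₁ f₂ f₃ f₄ : Ω → ℝ} (h₁ : Integrable f₁ μ) (h₂ : Integrable f₂ μ) (h₃ : Integrable f₃ μ)
    (h₄ : Integrable f₄ μ) (b c d : ℝ) :
    ∫ ω, (f₁ ω + b * f₂ ω + c * (f₃ ω + d * f₄ ω)) ∂μ =
      ∫ ω, f₁ ω ∂μ + b * ∫ ω, f₂ ω ∂μ + c * (∫ ω, f₃ ω ∂μ + d * ∫ ω, f₄ ω ∂μ) := by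
  have i₁ : Integrable (fun ω => f₁ ω + b * f₂ ω) μ := h₁.add (h₂.const_mul b)
  have i₂ : Integrable (fun ω => f₃ ω + d * f₄ ω) μ := h₃.add (h₄.const_mul d)
  rw [integral_add i₁ (i₂.const_mul c), integral_add h₁ (h₂.const_mul b), integral_const_mul,
    integral_const_mul, integral_add h₃ (h₄.const_mul d), integral_const_mul]

/-- One step of the truncated recursion: the Lyapunov function `‖T x‖ ^ (2 (k + 1))` contracts in
mean up to an additive error of order `a ^ p`. -/
theorem exists_one_step_bound {Ω E F : Type*} {mΩ : MeasurableSpace Ω}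
    [NormedAddCommGroup E] [InnerProductSpace ℝ E] [CompleteSpace E] [MeasurableSpace E]
    [BorelSpace E] [SecondCountableTopology E] [NormedAddCommGroup F] [InnerProductSpace ℝ F]
    (P : Measure Ω) [IsProbabilityMeasure P] (T : E →L[ℝ] F) (L : E →L[ℝ] E) {h ρ p C : ℝ}
    (hh : 0 < h) (hρ : ρ < 1) (hlow : ∀ x, ‖x‖ ≤ ‖T x‖)
    (hcontr : ∀ x, ‖T (x + h • L x)‖ ≤ ρ * ‖T x‖) (hp : 1 < p) (hC : 0 ≤ C)
    (k : ℕ) (hpk : p ≤ k + 2) :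
    ∃ c D : ℝ, 0 < c ∧ 0 ≤ D ∧ ∀ᶠ a : ℝ in 𝓝[>] 0, ∀ (m : MeasurableSpace Ω) (x w : Ω → E),
      m ≤ mΩ → Measurable[m] x → Measurable[mΩ] w → Integrable w P → P[w | m] =ᵐ[P] 0 →
      (∀ φ : Ω → ENNReal, Measurable[m] φ →
        ∫⁻ ω, φ ω * ENNReal.ofReal (‖w ω‖ ^ p) ∂P ≤
          ∫⁻ ω, φ ω * ENNReal.ofReal (C * (1 + ‖x ω‖) ^ p) ∂P) →
      ∀ (G : Set Ω) (R : ℝ), MeasurableSet[m] G → (∀ ω ∈ G, ‖x ω‖ ≤ R) →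
        ∫ ω in G, (if a * ‖w ω‖ ≤ 1 + ‖x ω‖ then
          ‖T (x ω + a • (L (x ω) + w ω))‖ ^ (2 * (k + 1)) else 0) ∂P ≤
        ∫ ω in G, ((1 - c * a) * ‖T (x ω)‖ ^ (2 * (k + 1)) + D * a ^ p) ∂P := by
  have hpk2 : p ≤ 2 * ((k : ℝ) + 1) := by
    have : (0 : ℝ) ≤ k := Nat.cast_nonneg k
    linarith
  obtain ⟨K, hK, hexp⟩ := exists_truncated_norm_add_pow_le F k hp hpk2 (norm_nonneg T)
  set c : ℝ := (1 - ρ) / h with hc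
  have hcpos : 0 < c := div_pos (by linarith) hh
  -- `K` bounds the direct `a ^ 2` term; `K * C` bounds the terms weighted by the relative moment,
  -- where `a ^ p * a ^ (2 - p) = a ^ 2`.
  obtain ⟨D, hD, hdrift⟩ := exists_drift_bound k (K := K + K * C) hcpos (by positivity) hp hpk
  refine ⟨c / 2, D, by positivity, hD, ?_⟩
  have hid : Tendsto (fun a : ℝ => a) (𝓝[>] 0) (𝓝 0) := tendsto_id.mono_left nhdsWithin_le_nhds
  filter_upwards [hdrift, self_mem_nhdsWithin, hid.eventually_le_const hh]
    with a hdrift ha hah m x w hm hx hw hwi hw0 hmom G R hG hR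
  have ha : 0 < a := ha
  have hcontract : ∀ v, ‖T (v + a • L v)‖ ≤ (1 - c * a) * ‖T v‖ := by
    intro v
    -- A convex combination of `v` and `v + h • L v`, so the contraction at step `h` passes to every
    -- step `a ≤ h`.
    have e : v + a • L v = (1 - a / h) • v + (a / h) • (v + h • L v) := by
      rw [smul_add, smul_smul, div_mul_cancel₀ _ hh.ne']
      module
    have hah' : a / h ≤ 1 := (div_le_one hh).2 hah
    rw [e, map_add, map_smul, map_smul]
    refine (norm_add_le _ _).trans ?_
    rw [norm_smul, norm_smul, Real.norm_of_nonneg (by linarith), Real.norm_of_nonneg (by positivity)]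
    calc (1 - a / h) * ‖T v‖ + a / h * ‖T (v + h • L v)‖
        ≤ (1 - a / h) * ‖T v‖ + a / h * (ρ * ‖T v‖) := by gcongr; exact hcontr v
      _ = _ := by rw [hc]; ring
  set y : Ω → F := fun ω => T (x ω + a • L (x ω)) with hy
  have hym : StronglyMeasurable[m] y :=
    (show Continuous fun v : E => T (v + a • L v) by fun_prop).comp_stronglyMeasurable
      hx.stronglyMeasurable
  have hynm : Measurable[m] fun ω => ‖y ω‖ := hym.norm.measurable
  have hsm : Measurable[m] fun ω => 1 + ‖x ω‖ := (measurable_norm.comp hx).const_add 1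
  have hTx : ∀ ω, ‖T (x ω)‖ ≤ ‖T‖ * ‖x ω‖ := fun ω => T.le_opNorm _
  have hTm : Measurable[m] fun ω => ‖T (x ω)‖ :=
    (show Continuous fun v : E => ‖T v‖ by fun_prop).measurable.comp hx
  have hca : 0 ≤ c * a := by positivity
  have hyT : ∀ ω, ‖y ω‖ ≤ ‖T‖ * ‖x ω‖ := fun ω => by
    refine (hcontract (x ω)).trans ?_
    have := norm_nonneg (T (x ω))
    nlinarith [hTx ω]
  have hys : ∀ ω, ‖y ω‖ ≤ ‖T‖ * (1 + ‖x ω‖) := fun ω => by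
    have := norm_nonneg T
    nlinarith [hyT ω]
  have hptw : ∀ ω, (if a * ‖w ω‖ ≤ 1 + ‖x ω‖ then
      ‖T (x ω + a • (L (x ω) + w ω))‖ ^ (2 * (k + 1)) else 0) ≤
      ‖y ω‖ ^ (2 * (k + 1)) + 2 * (k + 1) * a * inner ℝ (‖y ω‖ ^ (2 * k) • y ω) (T (w ω)) +
      K * (a ^ 2 * (‖y ω‖ ^ (2 * k) * (1 + ‖x ω‖) ^ 2) +
        (a * ‖w ω‖ / (1 + ‖x ω‖)) ^ p * ((1 + ‖x ω‖) ^ (2 * (k + 1)) +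
          a ^ (2 - p) * (‖y ω‖ ^ (2 * k) * (1 + ‖x ω‖) ^ 2))) := by
    intro ω
    have h1 := hexp (y ω) (a • T (w ω)) (1 + ‖x ω‖) (a * ‖w ω‖) a (by positivity) (by positivity) ha
      (by
        rw [norm_smul, Real.norm_of_nonneg ha.le, mul_left_comm]
        gcongr
        exact T.le_opNorm _) (hys ω)
    have e : T (x ω + a • (L (x ω) + w ω)) = y ω + a • T (w ω) := by
      simp only [hy, map_add, map_smul, smul_add]
      abel
    rw [e]
    refine h1.trans_eq ?_
    rw [inner_smul_right, real_inner_smul_left]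
    ring
  set q : Ω → ℝ := fun ω => (1 + ‖x ω‖) ^ (2 * (k + 1)) +
    a ^ (2 - p) * (‖y ω‖ ^ (2 * k) * (1 + ‖x ω‖) ^ 2) with hq
  have hap : 0 ≤ a ^ (2 - p) := Real.rpow_nonneg ha.le _
  have hqm : Measurable[m] q :=
    (hsm.pow_const _).add (((hynm.pow_const _).mul (hsm.pow_const _)).const_mul _)
  have hq0 : 0 ≤ q := fun ω => by simp only [hq, Pi.zero_apply]; positivity
  have hbdd : ∀ f : Ω → ℝ, Measurable[m] f → (∃ M, ∀ ω ∈ G, |f ω| ≤ M) → IntegrableOn f G P := by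
    rintro f hf ⟨M, hM⟩
    refine IntegrableOn.of_bound (measure_lt_top P G) (hf.mono hm le_rfl).aestronglyMeasurable M ?_
    exact (ae_restrict_mem (hm _ hG)).mono hM
  have hR0 : ∀ ω ∈ G, 0 ≤ R := fun ω hω => (norm_nonneg _).trans (hR ω hω)
  have hyR : ∀ ω ∈ G, ‖y ω‖ ≤ ‖T‖ * R := fun ω hω => (hyT ω).trans (by gcongr; exact hR ω hω)
  have hqR : ∀ ω ∈ G, q ω ≤ (1 + R) ^ (2 * (k + 1)) +
      a ^ (2 - p) * ((‖T‖ * R) ^ (2 * k) * (1 + R) ^ 2) := fun ω hω => by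
    have := hR ω hω
    have := hyR ω hω
    have := hR0 ω hω
    simp only [hq]
    gcongr
  have hi1 : IntegrableOn (fun ω => ‖y ω‖ ^ (2 * (k + 1))) G P := by
    refine hbdd _ (hynm.pow_const _) ⟨(‖T‖ * R) ^ (2 * (k + 1)), fun ω hω => ?_⟩
    rw [abs_of_nonneg (by positivity)]
    have := hyR ω hω
    gcongr
  have hi2 : IntegrableOn (fun ω => a ^ 2 * (‖y ω‖ ^ (2 * k) * (1 + ‖x ω‖) ^ 2)) G P := by
    refine hbdd _ (((hynm.pow_const _).mul (hsm.pow_const _)).const_mul _)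
      ⟨a ^ 2 * ((‖T‖ * R) ^ (2 * k) * (1 + R) ^ 2), fun ω hω => ?_⟩
    rw [abs_of_nonneg (by positivity)]
    have := hyR ω hω
    have := hR ω hω
    have := hR0 ω hω
    gcongr
  have hiq : IntegrableOn q G P := by
    refine hbdd _ hqm ⟨(1 + R) ^ (2 * (k + 1)) +
      a ^ (2 - p) * ((‖T‖ * R) ^ (2 * k) * (1 + R) ^ 2), fun ω hω => ?_⟩
    rw [abs_of_nonneg (hq0 ω)]
    exact hqR ω hω
  obtain ⟨hi3, h3⟩ := setIntegral_inner_eq_zero_of_condExp_eq_zero hm T hwi hw0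
    (h := fun ω => ‖y ω‖ ^ (2 * k) • y ω)
    ((hym.norm.pow (2 * k)).smul hym) hG (R := (‖T‖ * R) ^ (2 * k) * (‖T‖ * R)) (fun ω hω => by
      rw [norm_smul, Real.norm_of_nonneg (by positivity)]
      have := hyR ω hω
      have := hR0 ω hω
      gcongr)
  obtain ⟨hi4, h4⟩ := integral_relative_moment_le hm hx hw hC ha.le hmom (g := G.indicator q)
    (hqm.indicator hG) (Set.indicator_nonneg fun ω _ => hq0 ω)
    (R := |(1 + R) ^ (2 * (k + 1)) + a ^ (2 - p) * ((‖T‖ * R) ^ (2 * k) * (1 + R) ^ 2)|)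
    (fun ω => by
      by_cases hω : ω ∈ G
      · simpa [hω] using (hqR ω hω).trans (le_abs_self _)
      · simp [hω])
  have e4 : (fun ω => (a * ‖w ω‖ / (1 + ‖x ω‖)) ^ p * G.indicator q ω) =
      G.indicator fun ω => (a * ‖w ω‖ / (1 + ‖x ω‖)) ^ p * q ω := by
    ext ω
    by_cases hω : ω ∈ G <;> simp [hω]
  rw [e4, integrable_indicator_iff (hm _ hG)] at hi4
  rw [e4, integral_indicator (hm _ hG), integral_indicator (hm _ hG)] at h4
  have hrhs : IntegrableOn (fun ω => ‖y ω‖ ^ (2 * (k + 1)) +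
      2 * (k + 1) * a * inner ℝ (‖y ω‖ ^ (2 * k) • y ω) (T (w ω)) +
      K * (a ^ 2 * (‖y ω‖ ^ (2 * k) * (1 + ‖x ω‖) ^ 2) +
        (a * ‖w ω‖ / (1 + ‖x ω‖)) ^ p * q ω)) G P :=
    (hi1.add (hi3.const_mul _)).add ((hi2.add hi4).const_mul K)
  calc _ ≤ ∫ ω in G, (‖y ω‖ ^ (2 * (k + 1)) +
      2 * (k + 1) * a * inner ℝ (‖y ω‖ ^ (2 * k) • y ω) (T (w ω)) +
      K * (a ^ 2 * (‖y ω‖ ^ (2 * k) * (1 + ‖x ω‖) ^ 2) +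
        (a * ‖w ω‖ / (1 + ‖x ω‖)) ^ p * q ω)) ∂P := by
        -- The integrand on the left is nonnegative, so only the majorant has to be integrable.
        refine integral_mono_of_nonneg (ae_of_all _ fun ω => ?_) hrhs (ae_of_all _ hptw)
        simp only [Pi.zero_apply]
        split_ifs <;> positivity
    _ = ∫ ω in G, ‖y ω‖ ^ (2 * (k + 1)) ∂P +
        K * (∫ ω in G, a ^ 2 * (‖y ω‖ ^ (2 * k) * (1 + ‖x ω‖) ^ 2) ∂P +
          ∫ ω in G, (a * ‖w ω‖ / (1 + ‖x ω‖)) ^ p * q ω ∂P) := by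
        have := integral_add_four_mul hi1 hi3 hi2 hi4 (2 * (k + 1) * a) K 1
        simp only [one_mul, h3, mul_zero, add_zero] at this
        exact this
    _ ≤ ∫ ω in G, ‖y ω‖ ^ (2 * (k + 1)) ∂P +
        K * (∫ ω in G, a ^ 2 * (‖y ω‖ ^ (2 * k) * (1 + ‖x ω‖) ^ 2) ∂P +
          C * a ^ p * ∫ ω in G, q ω ∂P) := by gcongr
    _ = ∫ ω in G, (‖y ω‖ ^ (2 * (k + 1)) + K * (a ^ 2 * (‖y ω‖ ^ (2 * k) * (1 + ‖x ω‖) ^ 2) +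
          C * a ^ p * q ω)) ∂P := by
        have := integral_add_four_mul hi1 hi3 hi2 hiq 0 K (C * a ^ p)
        simp only [zero_mul, add_zero] at this
        exact this.symm
    _ ≤ _ := by
        refine setIntegral_mono_on (hi1.add ((hi2.add (hiq.const_mul _)).const_mul K)) ?_ (hm _ hG)
          fun ω hω => ?_
        · refine hbdd _ ?_ ⟨|1 - c / 2 * a| * (‖T‖ * R) ^ (2 * (k + 1)) + D * a ^ p, fun ω hω => ?_⟩
          · exact ((hTm.pow_const _).const_mul _).add_const _
          · have h5 : ‖T (x ω)‖ ≤ ‖T‖ * R := (hTx ω).trans (by gcongr; exact hR ω hω)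
            have h6 : 0 ≤ D * a ^ p := mul_nonneg hD (Real.rpow_nonneg ha.le _)
            refine (abs_add_le _ _).trans ?_
            rw [abs_mul, abs_of_nonneg h6, abs_of_nonneg (a := ‖T (x ω)‖ ^ (2 * (k + 1)))
              (by positivity)]
            gcongr
        · have h5 := hdrift ‖y ω‖ ‖T (x ω)‖ ‖x ω‖ (norm_nonneg _) (norm_nonneg _)
            (hcontract _) (hlow _)
          refine le_trans ?_ h5
          have h6 : a ^ p * a ^ (2 - p) = a ^ 2 := by
            rw [← Real.rpow_add ha, add_sub_cancel, Real.rpow_two]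
          have h7 : 0 ≤ K * (a ^ p * (1 + ‖x ω‖) ^ (2 * (k + 1))) := by
            have := Real.rpow_nonneg ha.le p
            positivity
          refine le_of_le_of_eq (le_add_of_nonneg_right h7) ?_
          simp only [hq]
          linear_combination K * C * (‖y ω‖ ^ (2 * k) * (1 + ‖x ω‖) ^ 2) * h6

/-! ### Supermartingale convergence, killing and restarting. -/

/-- A nonnegative adapted process whose conditional mean contracts by `1 - b k` up to a summable
error tends to zero almost surely when `∑ b k = ∞`. -/
theorem ae_tendsto_zero_of_setIntegral_succ_le {Ω : Type*} {mΩ : MeasurableSpace Ω}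
    {P : Measure Ω} [IsProbabilityMeasure P] {ℱ : Filtration ℕ mΩ} {Z : ℕ → Ω → ℝ}
    (hZ : StronglyAdapted ℱ Z) (hZ0 : ∀ k ω, 0 ≤ Z k ω) (hZi : ∀ k, Integrable (Z k) P)
    {b γ : ℕ → ℝ} (hb : ∀ k, 0 ≤ b k) (hγ : ∀ k, 0 ≤ γ k) (hγs : Summable γ) (hbs : ¬ Summable b)
    (h : ∀ k s, MeasurableSet[ℱ k] s →
      ∫ ω in s, Z (k + 1) ω ∂P ≤ ∫ ω in s, ((1 - b k) * Z k ω + γ k) ∂P) :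
    ∀ᵐ ω ∂P, Tendsto (fun k => Z k ω) atTop (𝓝 0) := by
  have hmean : ∀ n, ∫ ω, Z n ω ∂P + ∑ k ∈ Finset.range n, b k * ∫ ω, Z k ω ∂P ≤
      ∫ ω, Z 0 ω ∂P + ∑ k ∈ Finset.range n, γ k := by
    intro n
    induction n with
    | zero => simp
    | succ n ih =>
      have h1 := h n Set.univ MeasurableSet.univ
      simp only [setIntegral_univ] at h1
      rw [integral_add ((hZi n).const_mul _) (integrable_const _), integral_const_mul] at h1
      simp only [integral_const, probReal_univ, smul_eq_mul, one_mul] at h1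
      rw [Finset.sum_range_succ, Finset.sum_range_succ]
      linarith
  have hEZ0 : ∀ n, 0 ≤ ∫ ω, Z n ω ∂P := fun n => integral_nonneg (hZ0 n)
  have hΓ : ∀ n, ∑ k ∈ Finset.range n, γ k ≤ ∑' k, γ k := fun n =>
    hγs.sum_le_tsum _ fun k _ => hγ k
  set Γ := ∑' k, γ k
  have hbZ : ∀ n, ∑ k ∈ Finset.range n, b k * ∫ ω, Z k ω ∂P ≤ ∫ ω, Z 0 ω ∂P + Γ := fun n => by
    linarith [hmean n, hΓ n, hEZ0 n]
  have hEZ : ∀ n, ∫ ω, Z n ω ∂P ≤ ∫ ω, Z 0 ω ∂P + Γ := fun n => by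
    have : 0 ≤ ∑ k ∈ Finset.range n, b k * ∫ ω, Z k ω ∂P :=
      Finset.sum_nonneg fun k _ => mul_nonneg (hb k) (hEZ0 k)
    linarith [hmean n, hΓ n]
  have hsumE : Summable fun k => b k * ∫ ω, Z k ω ∂P :=
    summable_of_sum_range_le (fun k => mul_nonneg (hb k) (hEZ0 k)) hbZ
  have hsum : ∀ᵐ ω ∂P, Summable fun k => b k * Z k ω := by
    have hmeas : ∀ k, Measurable (Z k) := fun k =>
      ((hZ k).mono (ℱ.le k)).measurable
    have hmeas' : ∀ k, AEMeasurable (fun ω => ENNReal.ofReal (b k * Z k ω)) P := fun k =>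
      ((hmeas k).const_mul (b k)).ennreal_ofReal.aemeasurable
    have h1 : ∫⁻ ω, ∑' k, ENNReal.ofReal (b k * Z k ω) ∂P ≠ ⊤ := by
      rw [lintegral_tsum hmeas']
      have h2 : ∀ k, ∫⁻ ω, ENNReal.ofReal (b k * Z k ω) ∂P =
          ENNReal.ofReal (b k * ∫ ω, Z k ω ∂P) := fun k => by
        rw [← integral_const_mul, ofReal_integral_eq_lintegral_ofReal ((hZi k).const_mul _)
          (ae_of_all _ fun ω => mul_nonneg (hb k) (hZ0 k ω))]
      simp only [h2]
      exact hsumE.tsum_ofReal_ne_top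
    filter_upwards [ae_lt_top' (AEMeasurable.tsum hmeas') h1] with ω hω
    have h2 := ENNReal.summable_toReal hω.ne
    simpa only [ENNReal.toReal_ofReal (mul_nonneg (hb _) (hZ0 _ ω))] using h2
  -- Subtracting the accumulated errors leaves a supermartingale bounded in `L¹`, so `Z k` converges
  -- almost surely. A positive limit would make `b` summable by comparison with `b k * Z k`.
  have hsuper : Supermartingale (fun k ω => Z k ω - ∑ j ∈ Finset.range k, γ j) ℱ P := by
    refine supermartingale_of_setIntegral_succ_le
      (fun k => (hZ k).sub stronglyMeasurable_const)
      (fun k => (hZi k).sub (integrable_const _)) fun k s hs => ?_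
    have h1 := h k s hs
    rw [integral_sub (hZi _).integrableOn (integrable_const _).integrableOn,
      integral_sub (hZi _).integrableOn (integrable_const _).integrableOn]
    rw [integral_add ((hZi k).const_mul _).integrableOn (integrable_const _).integrableOn,
      integral_const_mul] at h1
    have h2 : 0 ≤ ∫ ω in s, Z k ω ∂P := integral_nonneg (hZ0 k)
    simp only [setIntegral_const, smul_eq_mul, Finset.sum_range_succ] at h1 ⊢
    nlinarith [mul_nonneg (hb k) h2]
  have hdi : ∀ n, Integrable (fun ω => Z n ω - ∑ j ∈ Finset.range n, γ j) P := fun n =>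
    (hZi n).sub (integrable_const _)
  have hconv := hsuper.neg.exists_ae_tendsto_of_bdd (R := (∫ ω, Z 0 ω ∂P + Γ + Γ).toNNReal)
    (fun n => by
      rw [Pi.neg_apply, eLpNorm_neg, eLpNorm_one_eq_lintegral_enorm,
        ← ofReal_integral_norm_eq_lintegral_enorm (hdi n)]
      refine ENNReal.ofReal_le_ofReal ?_
      calc ∫ ω, ‖Z n ω - ∑ j ∈ Finset.range n, γ j‖ ∂P ≤ ∫ ω, (Z n ω + Γ) ∂P := by
            refine integral_mono (hdi n).norm
              ((hZi n).add (integrable_const _)) fun ω => ?_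
            refine (norm_sub_le _ _).trans ?_
            rw [Real.norm_of_nonneg (hZ0 n ω), Real.norm_of_nonneg
              (Finset.sum_nonneg fun j _ => hγ j)]
            linarith [hΓ n]
        _ = ∫ ω, Z n ω ∂P + Γ := by
            rw [integral_add (hZi n) (integrable_const _)]
            simp
        _ ≤ _ := by linarith [hEZ n])
  filter_upwards [hsum, hconv] with ω hs ⟨l, hl⟩
  have h1 : Tendsto (fun k => Z k ω) atTop (𝓝 (Γ - l)) := by
    have := hγs.hasSum.tendsto_sum_nat.sub hl
    refine this.congr fun k => ?_
    simp
  have h0 : 0 ≤ Γ - l := ge_of_tendsto' h1 fun k => hZ0 k ω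
  rcases h0.eq_or_lt with he | hlt
  · rwa [← he] at h1
  · exfalso
    apply hbs
    refine Summable.of_norm_bounded_eventually_nat (g := fun k => (2 / (Γ - l)) * (b k * Z k ω))
      (hs.mul_left _) ?_
    filter_upwards [h1.eventually_const_lt (half_lt_self hlt)] with k hk
    rw [Real.norm_of_nonneg (hb k)]
    have e : b k = 2 / (Γ - l) * (b k * ((Γ - l) / 2)) := by field_simp
    calc b k = 2 / (Γ - l) * (b k * ((Γ - l) / 2)) := e
      _ ≤ _ := by
        have := hb k
        gcongr

/-- Convergence to zero on the event that the initial point is bounded and no increment is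
truncated. -/
theorem ae_tendsto_zero_of_forall_le {Ω E F : Type*} {mΩ : MeasurableSpace Ω}
    [NormedAddCommGroup E] [NormedSpace ℝ E] [MeasurableSpace E] [BorelSpace E]
    [SecondCountableTopology E] [NormedAddCommGroup F] [NormedSpace ℝ F]
    {P : Measure Ω} [IsProbabilityMeasure P] {ℱ : Filtration ℕ mΩ} {x w : ℕ → Ω → E} {a : ℕ → ℝ}
    (T : E →L[ℝ] F) (L : E →L[ℝ] E) (hlow : ∀ v, ‖v‖ ≤ ‖T v‖)
    (hx : ∀ k, Measurable[ℱ k] (x k)) (hw : ∀ k, Measurable[ℱ (k + 1)] (w k))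
    (hrec : ∀ k ω, x (k + 1) ω = x k ω + a k • (L (x k ω) + w k ω))
    (ha : ∀ k, 0 ≤ a k) {p c D : ℝ} (hc : 0 < c) (hD : 0 ≤ D)
    (has : ¬ Summable a) (hap : Summable fun k => a k ^ p) {q : ℕ} (hq : q ≠ 0)
    (hstep : ∀ k (G : Set Ω) (R : ℝ), MeasurableSet[ℱ k] G → (∀ ω ∈ G, ‖x k ω‖ ≤ R) →
      ∫ ω in G, (if a k * ‖w k ω‖ ≤ 1 + ‖x k ω‖ then
          ‖T (x k ω + a k • (L (x k ω) + w k ω))‖ ^ q else 0) ∂P ≤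
        ∫ ω in G, ((1 - c * a k) * ‖T (x k ω)‖ ^ q + D * a k ^ p) ∂P) (R : ℝ) :
    ∀ᵐ ω ∂P, ‖x 0 ω‖ ≤ R → (∀ k, a k * ‖w k ω‖ ≤ 1 + ‖x k ω‖) →
      Tendsto (fun k => x k ω) atTop (𝓝 0) := by
  -- `S k` involves only `w j` with `j < k`, hence is known at time `k`. On it each step moves the
  -- iterate by a bounded amount, which makes the killed process bounded at each time.
  set S : ℕ → Set Ω := fun k =>
    {ω | ‖x 0 ω‖ ≤ R ∧ ∀ j < k, a j * ‖w j ω‖ ≤ 1 + ‖x j ω‖} with hS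
  have hsucc : ∀ k, S (k + 1) = S k ∩ {ω | a k * ‖w k ω‖ ≤ 1 + ‖x k ω‖} := by
    intro k
    ext ω
    simp only [hS, Set.mem_ofPred_eq, Set.mem_inter_iff, Nat.lt_succ_iff_lt_or_eq, or_imp,
      forall_and, forall_eq, and_assoc]
  have hSm : ∀ k, MeasurableSet[ℱ k] (S k) := by
    intro k
    induction k with
    | zero =>
      have : S 0 = {ω | ‖x 0 ω‖ ≤ R} := by ext ω; simp [hS]
      rw [this]
      exact measurableSet_le (measurable_norm.comp (hx 0)) measurable_const
    | succ k ih =>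
      rw [hsucc]
      refine (ℱ.mono (Nat.le_succ k) _ ih).inter (measurableSet_le ?_ ?_)
      · exact (measurable_norm.comp (hw k)).const_mul _
      · exact (measurable_norm.comp ((hx k).mono (ℱ.mono (Nat.le_succ k)) le_rfl)).const_add _
  have hbd : ∀ k, ∃ M, ∀ ω ∈ S k, ‖x k ω‖ ≤ M := by
    intro k
    induction k with
    | zero => exact ⟨R, fun ω hω => hω.1⟩
    | succ k ih =>
      obtain ⟨M, hM⟩ := ih
      refine ⟨M + (a k * (‖L‖ * M) + (1 + M)), fun ω hω => ?_⟩
      rw [hsucc] at hω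
      have h1 := hM ω hω.1
      have h2 : a k * ‖w k ω‖ ≤ 1 + ‖x k ω‖ := hω.2
      have h3 : ‖a k • (L (x k ω) + w k ω)‖ ≤ a k * (‖L‖ * ‖x k ω‖) + a k * ‖w k ω‖ := by
        rw [norm_smul, Real.norm_of_nonneg (ha k), ← mul_add]
        gcongr
        · exact ha k
        · exact (norm_add_le _ _).trans (by gcongr; exact L.le_opNorm _)
      rw [hrec]
      refine (norm_add_le _ _).trans ?_
      have h4 : a k * (‖L‖ * ‖x k ω‖) ≤ a k * (‖L‖ * M) := by
        have := ha k
        gcongr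
      linarith
  have hTm : ∀ k, Measurable[ℱ k] fun ω => ‖T (x k ω)‖ ^ q := fun k =>
    (show Continuous fun v : E => ‖T v‖ ^ q by fun_prop).measurable.comp (hx k)
  set Z : ℕ → Ω → ℝ := fun k => (S k).indicator fun ω => ‖T (x k ω)‖ ^ q with hZdef
  have hZi : ∀ k, Integrable (Z k) P := by
    intro k
    obtain ⟨M, hM⟩ := hbd k
    refine Integrable.of_bound ((((hTm k).indicator (hSm k)).mono
      (ℱ.le k) le_rfl).aestronglyMeasurable) (|‖T‖ * M| ^ q) (ae_of_all _ fun ω => ?_)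
    by_cases hω : ω ∈ S k
    · have e : Z k ω = ‖T (x k ω)‖ ^ q := Set.indicator_of_mem hω _
      rw [e, norm_pow, norm_norm]
      gcongr
      refine (T.le_opNorm _).trans (le_trans ?_ (le_abs_self _))
      gcongr
      exact hM ω hω
    · have e : Z k ω = 0 := Set.indicator_of_notMem hω _
      rw [e, norm_zero]
      positivity
  have hZ0 : ∀ k ω, 0 ≤ Z k ω := fun k ω => Set.indicator_nonneg (fun ω _ => by positivity) ω
  have hap0 : ∀ k, 0 ≤ D * a k ^ p := fun k => mul_nonneg hD (Real.rpow_nonneg (ha k) p)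
  have hlim := ae_tendsto_zero_of_setIntegral_succ_le (P := P) (ℱ := ℱ) (Z := Z)
    (b := fun k => c * a k) (γ := fun k => D * a k ^ p)
    (fun k => ((hTm k).indicator (hSm k)).stronglyMeasurable) hZ0 hZi
    (fun k => mul_nonneg hc.le (ha k)) hap0 (hap.mul_left D)
    (fun hsum => has (by simpa [hc.ne'] using hsum.mul_left c⁻¹)) (fun k s hs => by
      obtain ⟨M, hM⟩ := hbd k
      have hSk := ℱ.le k _ (hSm k)
      have e1 : ∀ ω, Z (k + 1) ω = (S k).indicator (fun ω => if a k * ‖w k ω‖ ≤ 1 + ‖x k ω‖ then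
          ‖T (x k ω + a k • (L (x k ω) + w k ω))‖ ^ q else 0) ω := by
        intro ω
        by_cases h1 : ω ∈ S k
        · rw [Set.indicator_of_mem h1]
          by_cases h2 : a k * ‖w k ω‖ ≤ 1 + ‖x k ω‖
          · have h3 : ω ∈ S (k + 1) := by rw [hsucc]; exact ⟨h1, h2⟩
            rw [if_pos h2, ← hrec]
            exact Set.indicator_of_mem h3 _
          · have h3 : ω ∉ S (k + 1) := by rw [hsucc]; exact fun h => h2 h.2
            rw [if_neg h2]
            exact Set.indicator_of_notMem h3 _
        · have h3 : ω ∉ S (k + 1) := by rw [hsucc]; exact fun h => h1 h.1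
          rw [Set.indicator_of_notMem h1]
          exact Set.indicator_of_notMem h3 _
      simp only [e1]
      rw [setIntegral_indicator hSk]
      refine (hstep k (s ∩ S k) M (hs.inter (hSm k)) fun ω hω => hM ω hω.2).trans ?_
      have i1 : IntegrableOn (fun ω => (1 - c * a k) * ‖T (x k ω)‖ ^ q) (s ∩ S k) P := by
        have := (integrable_indicator_iff hSk).1 (hZi k)
        exact (this.mono_set Set.inter_subset_right).const_mul _
      rw [integral_add i1 (integrable_const _).integrableOn,
        integral_add ((hZi k).const_mul _).integrableOn (integrable_const _).integrableOn]
      refine add_le_add (le_of_eq ?_) ?_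
      · rw [integral_const_mul, integral_const_mul, setIntegral_indicator hSk]
      · simp only [setIntegral_const, smul_eq_mul]
        exact mul_le_mul_of_nonneg_right
          (measureReal_mono Set.inter_subset_left (measure_ne_top _ _)) (hap0 k))
  filter_upwards [hlim] with ω hω h0 hall
  have hmem : ∀ k, ω ∈ S k := fun k => ⟨h0, fun j _ => hall j⟩
  have h1 : Tendsto (fun k => ‖T (x k ω)‖ ^ q) atTop (𝓝 0) := by
    refine hω.congr fun k => ?_
    simp [hZdef, hmem k]
  have h2 : Tendsto (fun k => ‖T (x k ω)‖) atTop (𝓝 0) := by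
    have h3 := h1.rpow_const (p := (q : ℝ)⁻¹) (Or.inr (by positivity))
    rw [Real.zero_rpow (by positivity)] at h3
    refine h3.congr fun k => ?_
    exact Real.pow_rpow_inv_natCast (norm_nonneg _) hq
  exact squeeze_zero_norm (fun k => hlow _) h2

/-- Almost sure convergence of the linear stochastic approximation recursion with equilibrium `0`
and noise of conditional `p`-th moments growing at most like `(1 + ‖x‖) ^ p`. -/
theorem ae_tendsto_zero_of_contracting {Ω E F : Type*} {mΩ : MeasurableSpace Ω}
    [NormedAddCommGroup E] [InnerProductSpace ℝ E] [CompleteSpace E] [MeasurableSpace E]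
    [BorelSpace E] [SecondCountableTopology E] [NormedAddCommGroup F] [InnerProductSpace ℝ F]
    {P : Measure Ω} [IsProbabilityMeasure P] {ℱ : Filtration ℕ mΩ} {x w : ℕ → Ω → E} {a : ℕ → ℝ}
    (T : E →L[ℝ] F) (L : E →L[ℝ] E) {h ρ p C : ℝ} (hh : 0 < h) (hρ : ρ < 1)
    (hlow : ∀ v, ‖v‖ ≤ ‖T v‖) (hcontr : ∀ v, ‖T (v + h • L v)‖ ≤ ρ * ‖T v‖)
    (hp : 1 < p) (hC : 0 ≤ C)
    (hx : ∀ k, Measurable[ℱ k] (x k)) (hw : ∀ k, Measurable[ℱ (k + 1)] (w k))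
    (hrec : ∀ k ω, x (k + 1) ω = x k ω + a k • (L (x k ω) + w k ω))
    (hwi : ∀ k, Integrable (w k) P) (hw0 : ∀ k, P[w k | ℱ k] =ᵐ[P] 0)
    (hmom : ∀ k (φ : Ω → ENNReal), Measurable[ℱ k] φ →
        ∫⁻ ω, φ ω * ENNReal.ofReal (‖w k ω‖ ^ p) ∂P ≤
          ∫⁻ ω, φ ω * ENNReal.ofReal (C * (1 + ‖x k ω‖) ^ p) ∂P)
    (ha : ∀ k, 0 < a k) (ha0 : Tendsto a atTop (𝓝 0))
    (has : ¬ Summable a) (hap : Summable fun k => a k ^ p) :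
    ∀ᵐ ω ∂P, Tendsto (fun k => x k ω) atTop (𝓝 0) := by
  -- Any `κ ≥ p` satisfies the requirement `p ≤ κ + 2` of the drift bound.
  obtain ⟨κ, hκ⟩ := exists_nat_ge p
  have hwm : ∀ k, Measurable (w k) := fun k => (hw k).mono (ℱ.le _) le_rfl
  obtain ⟨c, D, hc, hD, hev⟩ := exists_one_step_bound (Ω := Ω) P T L hh hρ hlow hcontr hp hC κ
    (by linarith)
  have hev' := (tendsto_nhdsWithin_iff.2
    ⟨ha0, Eventually.of_forall fun k => ha k⟩).eventually hev
  obtain ⟨N₁, hN₁⟩ := eventually_atTop.1 hev'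
  have hBC : ∀ᵐ ω ∂P, ∀ᶠ k in atTop, a k * ‖w k ω‖ ≤ 1 + ‖x k ω‖ := by
    have hprob : ∀ k, P {ω | ¬ a k * ‖w k ω‖ ≤ 1 + ‖x k ω‖} ≤ ENNReal.ofReal (C * a k ^ p) := by
      intro k
      obtain ⟨hi, hle⟩ := integral_relative_moment_le (ℱ.le k) (hx k) (hwm k) hC (ha k).le
        (hmom k) (g := fun _ => 1) measurable_const (fun _ => zero_le_one) (R := 1) (fun _ => le_rfl)
      have h1 := mul_meas_ge_le_integral_of_nonneg (ae_of_all _ fun ω => mul_nonneg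
        (Real.rpow_nonneg (div_nonneg (mul_nonneg (ha k).le (norm_nonneg (w k ω)))
          (by positivity : 0 ≤ 1 + ‖x k ω‖)) p) zero_le_one) hi 1
      simp only [mul_one, integral_const, probReal_univ, smul_eq_mul, one_mul] at h1 hle
      have h2 := ENNReal.ofReal_le_ofReal (h1.trans hle)
      rw [ofReal_measureReal] at h2
      refine le_trans (measure_mono fun ω hω => ?_) h2
      have hs : 0 < 1 + ‖x k ω‖ := by positivity
      simp only [Set.mem_ofPred_eq, not_le] at hω ⊢
      exact Real.one_le_rpow ((one_le_div hs).2 hω.le) (by linarith)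
    have hfin : ∑' k, P {ω | ¬ a k * ‖w k ω‖ ≤ 1 + ‖x k ω‖} ≠ ⊤ :=
      ne_top_of_le_ne_top (hap.mul_left C).tsum_ofReal_ne_top (ENNReal.tsum_le_tsum hprob)
    filter_upwards [ae_eventually_notMem hfin] with ω hω
    filter_upwards [hω] with k hk
    simpa using hk
  -- Integer `R` and `N` keep the exceptional sets countable in number. Each path is later matched
  -- with a restart time after its last truncation and a bound for its restart point.
  have hmain : ∀ᵐ ω ∂P, ∀ N R : ℕ, N₁ ≤ N → ‖x (N + 0) ω‖ ≤ R →
      (∀ k, a (N + k) * ‖w (N + k) ω‖ ≤ 1 + ‖x (N + k) ω‖) →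
      Tendsto (fun k => x (N + k) ω) atTop (𝓝 0) := by
    rw [ae_all_iff]
    intro N
    rw [ae_all_iff]
    intro R
    by_cases hN : N₁ ≤ N
    swap
    · exact ae_of_all _ fun ω h => absurd h hN
    let 𝒢 : Filtration ℕ mΩ :=
      ⟨fun k => ℱ (N + k), fun i j hij => ℱ.mono (Nat.add_le_add_left hij N), fun k => ℱ.le _⟩
    have hshift : ∀ f : ℕ → ℝ, Summable (fun k => f (N + k)) ↔ Summable f := fun f => by
      simpa only [add_comm N] using summable_nat_add_iff (f := f) N
    have := ae_tendsto_zero_of_forall_le (P := P) (ℱ := 𝒢) (x := fun k => x (N + k))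
      (w := fun k => w (N + k)) (a := fun k => a (N + k)) T L hlow (fun k => hx _) (fun k => hw _)
      (fun k ω => hrec _ ω) (fun k => (ha _).le) hc hD (p := p) (by rwa [hshift])
      ((hshift fun k => a k ^ p).2 hap) (q := 2 * (κ + 1)) (by omega)
      (fun k G R hG hR => hN₁ (N + k) (by omega) (ℱ (N + k)) _ _ (ℱ.le _) (hx _) (hwm _) (hwi _)
        (hw0 _) (hmom _) G R hG hR) R
    filter_upwards [this] with ω hω _ using hω
  filter_upwards [hBC, hmain] with ω h1 h2
  obtain ⟨N₂, hN₂⟩ := eventually_atTop.1 h1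
  obtain ⟨R, hR⟩ := exists_nat_ge ‖x (max N₁ N₂ + 0) ω‖
  have h3 := h2 (max N₁ N₂) R (le_max_left _ _) hR fun k =>
    hN₂ _ ((le_max_right N₁ N₂).trans (Nat.le_add_right _ _))
  simp only [add_comm (max N₁ N₂)] at h3
  exact (tendsto_add_atTop_iff_nat (max N₁ N₂)).1 h3

/-! ### From the history of the iterates to the sufficiency statement. -/

/-- The filtration generated by a sequence of random variables, in terms of `history`. -/
def historyFiltration {Ω E : Type*} [mΩ : MeasurableSpace Ω] [MeasurableSpace E]
    {x : ℕ → Ω → E} (hx : ∀ k, Measurable (x k)) : Filtration ℕ mΩ where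
  seq := history x
  mono' _ j hij := iSup_le fun l =>
    le_iSup (fun l : Fin (j + 1) => MeasurableSpace.comap (x l) inferInstance)
      ⟨l, l.2.trans_le (Nat.succ_le_succ hij)⟩
  le' k := history_le hx k

theorem measurable_history {Ω E : Type*} [MeasurableSpace E] (x : ℕ → Ω → E) {j k : ℕ}
    (hjk : j ≤ k) : Measurable[history x k] (x j) :=
  (comap_measurable (x j)).mono
    (le_iSup (fun l : Fin (k + 1) => MeasurableSpace.comap (x l) inferInstance)
      ⟨j, Nat.lt_succ_of_le hjk⟩) le_rfl

/-- A bound on a conditional expectation passes to weighted integrals. -/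
theorem lintegral_mul_le_of_condLExp_le {Ω : Type*} {m mΩ : MeasurableSpace Ω} {P : Measure Ω}
    [IsProbabilityMeasure P] (hm : m ≤ mΩ) {f g : Ω → ENNReal} (hf : Measurable f)
    (hg : Measurable g) (h : ∀ᵐ ω ∂P, condLExp m P f ω ≤ g ω) {φ : Ω → ENNReal}
    (hφ : Measurable[m] φ) : ∫⁻ ω, φ ω * f ω ∂P ≤ ∫⁻ ω, φ ω * g ω ∂P := by
  -- Only the restriction of the measure with density `f` to `m` matters for `m`-measurable `φ`, and
  -- the conditional bound compares these restrictions set by set.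
  have key : ∀ f : Ω → ENNReal, Measurable f →
      ∫⁻ ω, φ ω * f ω ∂P = ∫⁻ ω, φ ω ∂((P.withDensity f).trim hm) := fun f hf => by
    rw [lintegral_trim hm hφ, lintegral_withDensity_eq_lintegral_mul _ hf (hφ.mono hm le_rfl)]
    simp only [Pi.mul_apply, mul_comm]
  rw [key f hf, key g hg]
  refine lintegral_mono' (Measure.le_iff.2 fun s hs => ?_) le_rfl
  rw [trim_measurableSet_eq hm hs, trim_measurableSet_eq hm hs, withDensity_apply _ (hm _ hs),
    withDensity_apply _ (hm _ hs), ← setLIntegral_condLExp hm P f hs]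
  exact lintegral_mono_ae (ae_restrict_of_ae h)

/-- With `s = ξ` and `s = ξ p` this converts the two endpoints of `(1 / p, 1]` into divergence of `∑
a_k` and convergence of `∑ a_k ^ p`. -/
theorem summable_mul_nat_add_rpow_iff {α K s : ℝ} (hα : 0 < α) (hK : 0 < K) :
    (Summable fun k : ℕ => α * ((k : ℝ) + K) ^ (-s)) ↔ 1 < s := by
  rw [summable_mul_left_iff hα.ne', ← Real.summable_one_div_nat_add_rpow K s]
  refine summable_congr fun k => ?_
  have hk : 0 < (k : ℝ) + K := by positivity
  rw [abs_of_pos hk, one_div, Real.rpow_neg hk.le]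

theorem rpow_mul_nat_add_rpow {α K ξ p : ℝ} (hα : 0 < α) (hK : 0 < K) (k : ℕ) :
    (α * ((k : ℝ) + K) ^ (-ξ)) ^ p = α ^ p * ((k : ℝ) + K) ^ (-(ξ * p)) := by
  have hk : 0 ≤ (k : ℝ) + K := by positivity
  rw [Real.mul_rpow hα.le (Real.rpow_nonneg hk _), ← Real.rpow_mul hk, neg_mul]

/-- Almost sure convergence of linear stochastic approximation for `ξ ∈ (1 / p, 1]`. -/
theorem IsLinearSA.ae_tendsto {d : ℕ} (hd : 0 < d) {A : Matrix (Fin d) (Fin d) ℝ}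
    (hA : IsHurwitz A) {b xstar : EuclideanSpace ℝ (Fin d)}
    (hstar : A.toEuclideanLin xstar + b = 0) {p α K ξ : ℝ} (hp : 1 < p) (hα : 0 < α) (hK : 0 < K)
    (hξ : ξ ∈ Set.Ioc (1 / p) 1) {Ω : Type*} [MeasurableSpace Ω] {P : Measure Ω}
    [IsProbabilityMeasure P] {x w : ℕ → Ω → EuclideanSpace ℝ (Fin d)}
    (hsa : IsLinearSA A b (fun k => α * ((k : ℝ) + K) ^ (-ξ)) x w)
    (hub : IsUnbiasedNoise P x w) (hmg : HasNoiseMomentGrowth P p xstar x w) :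
    ∀ᵐ ω ∂P, Tendsto (fun k => x k ω) atTop (𝓝 xstar) := by
  obtain ⟨h, hh, n, hn⟩ := hA.exists_pow_norm_lt hd
  set L := Matrix.toEuclideanCLM (n := Fin d) (𝕜 := ℝ) A with hL
  have hLA : ∀ v, L v = A.toEuclideanLin v := fun v => rfl
  obtain ⟨m, T, ρ, -, hρ, hlow, hcontr⟩ := exists_contracting_embedding _ n hn
  obtain ⟨Ap, Bp, hAp, hBp, hmom⟩ := hmg
  obtain ⟨hxm, hwm, hrec⟩ := hsa
  set a : ℕ → ℝ := fun k => α * ((k : ℝ) + K) ^ (-ξ) with ha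
  have hap : ∀ k, 0 < a k := fun k => by
    have : 0 < (k : ℝ) + K := by positivity
    have := Real.rpow_pos_of_pos this (-ξ)
    positivity
  have hξ0 : 0 < ξ := lt_trans (by positivity) hξ.1
  have ha0 : Tendsto a atTop (𝓝 0) := by
    have h1 : Tendsto (fun k : ℕ => (k : ℝ) + K) atTop atTop :=
      tendsto_atTop_add_const_right _ _ tendsto_natCast_atTop_atTop
    simpa using ((tendsto_rpow_neg_atTop hξ0).comp h1).const_mul α
  have hxm' : ∀ k, Measurable[history x k] fun ω => x k ω - xstar := fun k =>
    (measurable_id.sub_const xstar).comp (measurable_history x le_rfl)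
  -- As `a k ≠ 0`, the recursion can be solved for `w k` in terms of `x k` and `x (k + 1)`.
  have hwm' : ∀ k, Measurable[history x (k + 1)] (w k) := by
    intro k
    have hg : Measurable fun z : EuclideanSpace ℝ (Fin d) × EuclideanSpace ℝ (Fin d) =>
        (a k)⁻¹ • (z.1 - z.2) - L z.2 - b := by fun_prop
    have e : w k = (fun z : EuclideanSpace ℝ (Fin d) × EuclideanSpace ℝ (Fin d) =>
        (a k)⁻¹ • (z.1 - z.2) - L z.2 - b) ∘ fun ω => (x (k + 1) ω, x k ω) := by
      ext1 ω
      simp only [Function.comp_apply]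
      rw [hrec k ω, add_sub_cancel_left, inv_smul_smul₀ (hap k).ne', hLA]
      abel
    rw [e]
    exact hg.comp ((measurable_history x le_rfl).prodMk (measurable_history x (Nat.le_succ k)))
  have key := ae_tendsto_zero_of_contracting (P := P) (ℱ := historyFiltration hxm)
    (x := fun k ω => x k ω - xstar) (w := w) (a := a) T L (C := Ap + Bp) hh hρ hlow
    (fun v => by simpa using hcontr v) hp (by positivity)
    hxm'
    hwm'
    (fun k ω => by
      simp only [hrec k ω, map_sub, hLA]
      rw [eq_neg_of_add_eq_zero_left hstar]
      module)
    (fun k => (hub k).1) (fun k => (hub k).2)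
    (fun k φ hφ => by
      have hg : Measurable fun ω => ENNReal.ofReal ((Ap + Bp) * (1 + ‖x k ω - xstar‖) ^ p) := by
        have := hxm k
        fun_prop
      have hf : Measurable fun ω => ENNReal.ofReal (‖w k ω‖ ^ p) := by
        have := hwm k
        fun_prop
      refine lintegral_mul_le_of_condLExp_le (history_le hxm k) hf hg ?_ hφ
      filter_upwards [hmom k] with ω hω
      refine hω.trans (ENNReal.ofReal_le_ofReal ?_)
      have h0 := norm_nonneg (x k ω - xstar)
      have h1 : 1 ≤ (1 + ‖x k ω - xstar‖) ^ p := Real.one_le_rpow (by linarith) (by linarith)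
      have h2 : ‖x k ω - xstar‖ ^ p ≤ (1 + ‖x k ω - xstar‖) ^ p :=
        Real.rpow_le_rpow h0 (by linarith) (by linarith)
      nlinarith)
    hap ha0
    (by
      rw [ha, summable_mul_nat_add_rpow_iff hα hK]
      exact not_lt.2 hξ.2)
    (by
      simp only [ha, rpow_mul_nat_add_rpow hα hK]
      rw [summable_mul_nat_add_rpow_iff (Real.rpow_pos_of_pos hα p) hK]
      have := hξ.1
      rwa [div_lt_iff₀ (by linarith)] at this)
  filter_upwards [key] with ω hω
  simpa using hω.add_const xstar

-- Independent three-point noise.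

universe u

/-- Independent real random variables with prescribed laws exist in every universe. -/
theorem exists_iIndepFun_real (μ : ℕ → Measure ℝ) [∀ k, IsProbabilityMeasure (μ k)] :
    ∃ (Ω : Type u) (_ : MeasurableSpace Ω) (P : Measure Ω) (ζ : ℕ → Ω → ℝ),
      IsProbabilityMeasure P ∧ (∀ k, Measurable (ζ k)) ∧ (∀ k, P.map (ζ k) = μ k) ∧
      ProbabilityTheory.iIndepFun ζ P := by
  have : ∀ k, IsProbabilityMeasure ((μ k).map (ULift.up.{u} : ℝ → ULift.{u} ℝ)) := fun k =>
    Measure.isProbabilityMeasure_map measurable_up.aemeasurable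
  obtain ⟨Ω, mΩ, P, X, hX, hlaw, hind, hP⟩ := ProbabilityTheory.exists_hasLaw_indepFun
    (fun _ : ℕ => ULift.{u} ℝ) fun k => (μ k).map ULift.up
  refine ⟨Ω, mΩ, P, fun k => ULift.down ∘ X k, hP, fun k => measurable_down.comp (hX k),
    fun k => ?_, hind.comp _ fun k => measurable_down⟩
  rw [← Measure.map_map measurable_down (hX k), (hlaw k).map_eq,
    Measure.map_map measurable_down measurable_up]
  exact Measure.map_id

/-- The symmetric law on `{-m, 0, m}` giving mass `q` to `{-m, m}` (for `m ≠ 0`). -/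
noncomputable def symmetricThreePoint (q m : ℝ) : Measure ℝ :=
  ENNReal.ofReal (1 - q) • Measure.dirac 0 +
    ENNReal.ofReal (q / 2) • (Measure.dirac m + Measure.dirac (-m))

theorem isProbabilityMeasure_symmetricThreePoint {q : ℝ} (m : ℝ) (hq : q ∈ Set.Icc (0 : ℝ) 1) :
    IsProbabilityMeasure (symmetricThreePoint q m) := by
  refine ⟨?_⟩
  simp only [symmetricThreePoint, Measure.coe_add, Measure.coe_smul, Pi.add_apply, Pi.smul_apply,
    measure_univ, smul_eq_mul, mul_one]
  rw [one_add_one_eq_two, ← ENNReal.ofReal_ofNat, ← ENNReal.ofReal_mul (by linarith [hq.1]),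
    ← ENNReal.ofReal_add (by linarith [hq.2]) (by linarith [hq.1])]
  simp

theorem integrable_id_symmetricThreePoint (q m : ℝ) :
    Integrable (fun t : ℝ => t) (symmetricThreePoint q m) := by
  have h : ∀ c : ℝ, Integrable (fun t : ℝ => t) (Measure.dirac c) := fun c =>
    integrable_dirac (by simp)
  exact ((h 0).smul_measure ENNReal.ofReal_ne_top).add_measure
    (((h m).add_measure (h (-m))).smul_measure ENNReal.ofReal_ne_top)

theorem integral_id_symmetricThreePoint (q m : ℝ) : ∫ t, t ∂(symmetricThreePoint q m) = 0 := by
  have h : ∀ c : ℝ, Integrable (fun t : ℝ => t) (Measure.dirac c) := fun c =>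
    integrable_dirac (by simp)
  rw [symmetricThreePoint, integral_add_measure ((h 0).smul_measure ENNReal.ofReal_ne_top)
    (((h m).add_measure (h (-m))).smul_measure ENNReal.ofReal_ne_top), integral_smul_measure,
    integral_smul_measure, integral_add_measure (h m) (h (-m))]
  simp

theorem lintegral_rpow_symmetricThreePoint_le {q m p : ℝ} (hp : 0 < p) (hq : 0 ≤ q) (hm : 0 ≤ m)
    (h : q * m ^ p ≤ 1) :
    ∫⁻ t, ENNReal.ofReal (|t| ^ p) ∂(symmetricThreePoint q m) ≤ 1 := by
  have hmp : 0 ≤ m ^ p := Real.rpow_nonneg hm p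
  simp only [symmetricThreePoint, lintegral_add_measure, lintegral_smul_measure, lintegral_dirac,
    abs_zero, Real.zero_rpow hp.ne', ENNReal.ofReal_zero, mul_zero, zero_add, abs_neg,
    abs_of_nonneg hm, smul_eq_mul]
  rw [← ENNReal.ofReal_add hmp hmp, ← ENNReal.ofReal_mul (by linarith), ← ENNReal.ofReal_one]
  exact ENNReal.ofReal_le_ofReal (by linarith)

/-- Only a lower bound, since for `m = 0` the atom at the origin counts as well. -/
theorem le_symmetricThreePoint_abs_eq {q m : ℝ} (hq : 0 ≤ q) (hm : 0 ≤ m) :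
    ENNReal.ofReal q ≤ symmetricThreePoint q m {t | |t| = m} := by
  have hs : MeasurableSet {t : ℝ | |t| = m} := measurableSet_eq_fun (by fun_prop) (by fun_prop)
  simp only [symmetricThreePoint, Measure.coe_add, Measure.coe_smul, Pi.add_apply, Pi.smul_apply,
    Measure.dirac_apply' _ hs, smul_eq_mul]
  refine le_trans (le_of_eq ?_) le_add_self
  have h1 : m ∈ {t : ℝ | |t| = m} := abs_of_nonneg hm
  have h2 : -m ∈ {t : ℝ | |t| = m} := (abs_neg m).trans (abs_of_nonneg hm)
  rw [Set.indicator_of_mem h1, Set.indicator_of_mem h2, Pi.one_apply, Pi.one_apply,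
    one_add_one_eq_two, ← ENNReal.ofReal_ofNat, ← ENNReal.ofReal_mul (by linarith)]
  congr 1
  ring

/-- The conditional expectation of a nonnegative random variable given an independent σ-algebra
is its mean. -/
theorem condLExp_ae_eq_lintegral_of_indep {Ω : Type*} {m₁ m₂ mΩ : MeasurableSpace Ω}
    {P : Measure Ω} [IsProbabilityMeasure P] (h₁ : m₁ ≤ mΩ) (h₂ : m₂ ≤ mΩ) {f : Ω → ENNReal}
    (hf : Measurable[m₁] f) (hind : ProbabilityTheory.Indep m₁ m₂ P) :
    condLExp m₂ P f =ᵐ[P] fun _ => ∫⁻ ω, f ω ∂P := by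
  refine (ae_eq_condLExp h₂ P f measurable_const fun s hs => ?_).symm
  have hone : Measurable[m₂] (s.indicator (1 : Ω → ENNReal)) :=
    (measurable_indicator_const_iff (m := m₂) (1 : ENNReal)).2 hs
  have h := ProbabilityTheory.lintegral_mul_eq_lintegral_mul_lintegral_of_independent_measurableSpace
    h₁ h₂ hind hf (g := s.indicator 1) hone
  rw [lintegral_indicator_one (h₂ _ hs)] at h
  rw [setLIntegral_const, ← h, ← lintegral_indicator (h₂ _ hs)]
  refine lintegral_congr fun ω => ?_
  by_cases hω : ω ∈ s <;> simp [hω]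

/-- Iterates of the linear recursion from a deterministic starting point, driven by scalar noise
in a fixed direction. -/
noncomputable def linearSAIterates {d : ℕ} {Ω : Type*} (A : Matrix (Fin d) (Fin d) ℝ)
    (b x₀ v : EuclideanSpace ℝ (Fin d)) (a : ℕ → ℝ) (ζ : ℕ → Ω → ℝ) :
    ℕ → Ω → EuclideanSpace ℝ (Fin d)
  | 0, _ => x₀
  | k + 1, ω => linearSAIterates A b x₀ v a ζ k ω +
      a k • (A.toEuclideanLin (linearSAIterates A b x₀ v a ζ k ω) + b + ζ k ω • v)

theorem measurable_linearSAIterates {d : ℕ} {Ω : Type*} {m : MeasurableSpace Ω}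
    (A : Matrix (Fin d) (Fin d) ℝ) (b x₀ v : EuclideanSpace ℝ (Fin d)) (a : ℕ → ℝ) {ζ : ℕ → Ω → ℝ}
    {k : ℕ} (hζ : ∀ j < k, Measurable (ζ j)) : Measurable (linearSAIterates A b x₀ v a ζ k) := by
  induction k with
  | zero => exact measurable_const
  | succ k ih =>
    have hg : Measurable fun z : EuclideanSpace ℝ (Fin d) × ℝ =>
        z.1 + a k • (A.toEuclideanLin z.1 + b + z.2 • v) := by
      have : Continuous A.toEuclideanLin := LinearMap.continuous_of_finiteDimensional _
      exact Continuous.measurable (by fun_prop)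
    exact hg.comp ((ih fun j hj => hζ j (hj.trans (Nat.lt_succ_self k))).prodMk
      (hζ k (Nat.lt_succ_self k)))

/-- Admissible pairs started at the equilibrium, with independent symmetric noise of prescribed
size `m k`, attained with probability at least `q k`. -/
theorem exists_admissible_pair {d : ℕ} (hd : 0 < d) (A : Matrix (Fin d) (Fin d) ℝ)
    (b xstar : EuclideanSpace ℝ (Fin d)) (a : ℕ → ℝ) {p : ℝ} (hp : 0 < p) {q m : ℕ → ℝ}
    (hq : ∀ k, q k ∈ Set.Icc (0 : ℝ) 1) (hm : ∀ k, 0 ≤ m k) (hqm : ∀ k, q k * m k ^ p ≤ 1) :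
    ∃ (Ω : Type u) (_ : MeasurableSpace Ω) (P : Measure Ω) (_ : IsProbabilityMeasure P)
      (x w : ℕ → Ω → EuclideanSpace ℝ (Fin d)),
      IsLinearSA A b a x w ∧ IsUnbiasedNoise P x w ∧ HasNoiseMomentGrowth P p xstar x w ∧
      (∀ ω, x 0 ω = xstar) ∧ ProbabilityTheory.iIndepFun (fun k ω => ‖w k ω‖) P ∧
      ∀ k, ENNReal.ofReal (q k) ≤ P {ω | ‖w k ω‖ = m k} := by
  have hμ : ∀ k, IsProbabilityMeasure (symmetricThreePoint (q k) (m k)) := fun k =>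
    isProbabilityMeasure_symmetricThreePoint _ (hq k)
  obtain ⟨Ω, mΩ, P, ζ, hP, hζm, hlaw, hind⟩ :=
    exists_iIndepFun_real.{u} fun k => symmetricThreePoint (q k) (m k)
  set v : EuclideanSpace ℝ (Fin d) := EuclideanSpace.single ⟨0, hd⟩ 1 with hv
  have hv1 : ‖v‖ = 1 := by simp [hv]
  set x := linearSAIterates A b xstar v a ζ with hx
  have hwn : ∀ k ω, ‖ζ k ω • v‖ = |ζ k ω| := fun k ω => by
    rw [norm_smul, hv1, mul_one, Real.norm_eq_abs]
  have hxm : ∀ k, Measurable (x k) := fun k =>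
    measurable_linearSAIterates A b xstar v a fun j _ => hζm j
  have hζle : ∀ k, MeasurableSpace.comap (ζ k) inferInstance ≤ mΩ := fun k => (hζm k).comap_le
  -- The starting point is deterministic, so `x 0, …, x k` depend only on `ζ i` with `i < k`.
  have hindep : ∀ k, ProbabilityTheory.Indep (MeasurableSpace.comap (ζ k) inferInstance)
      (history x k) P := by
    intro k
    have h1 := ProbabilityTheory.indep_iSup_of_disjoint hζle
      ((ProbabilityTheory.iIndepFun_iff_iIndep _ _ _).1 hind)
      (S := {k}) (T := Set.Iio k) (by simp)
    refine ProbabilityTheory.indep_of_indep_of_le_left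
      (ProbabilityTheory.indep_of_indep_of_le_right h1 ?_) ?_
    · refine iSup_le fun j => Measurable.comap_le ?_
      refine measurable_linearSAIterates A b xstar v a fun i hi => ?_
      have hik : i ∈ Set.Iio k := lt_of_lt_of_le hi (Nat.lt_succ_iff.1 j.2)
      exact (comap_measurable (ζ i)).mono
        (le_iSup₂ (f := fun i (_ : i ∈ Set.Iio k) => MeasurableSpace.comap (ζ i) inferInstance)
          i hik) le_rfl
    · exact le_iSup₂ (f := fun i (_ : i ∈ ({k} : Set ℕ)) =>
        MeasurableSpace.comap (ζ i) inferInstance) k rfl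
  have hζi : ∀ k, Integrable (ζ k) P := fun k => by
    have := integrable_id_symmetricThreePoint (q k) (m k)
    rw [← hlaw k] at this
    exact this.comp_measurable (hζm k)
  refine ⟨Ω, mΩ, P, hP, x, fun k ω => ζ k ω • v, ⟨hxm, fun k => (hζm k).smul_const v,
    fun k ω => rfl⟩, fun k => ⟨(hζi k).smul_const v, ?_⟩, ⟨1, 0, one_pos, le_rfl, fun k => ?_⟩,
    fun ω => rfl, ?_, fun k => ?_⟩
  · refine (condExp_indep_eq (hζle k) (history_le hxm k) ?_ (hindep k)).trans ?_
    · exact ((comap_measurable (ζ k)).smul_const v).stronglyMeasurable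
    · rw [integral_smul_const]
      have h1 : ∫ ω, ζ k ω ∂P = 0 := by
        rw [← integral_id_symmetricThreePoint (q k) (m k), ← hlaw k,
          integral_map (hζm k).aemeasurable (by fun_prop)]
      rw [h1, zero_smul]
      rfl
  · have hg : Measurable fun t : ℝ => ENNReal.ofReal (|t| ^ p) := by fun_prop
    have h1 : ∫⁻ ω, ENNReal.ofReal (|ζ k ω| ^ p) ∂P ≤ 1 := by
      rw [← lintegral_map (f := fun t : ℝ => ENNReal.ofReal (|t| ^ p)) hg (hζm k), hlaw k]
      exact lintegral_rpow_symmetricThreePoint_le hp (hq k).1 (hm k) (hqm k)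
    simp only [hwn]
    filter_upwards [condLExp_ae_eq_lintegral_of_indep (hζle k) (history_le hxm k)
      (hg.comp (comap_measurable (ζ k))) (hindep k)] with ω hω
    simp only [Function.comp_def] at hω
    rw [hω]
    simpa using h1
  · simp only [hwn]
    exact hind.comp (fun _ t => |t|) fun _ => by fun_prop
  · simp only [hwn]
    refine (le_symmetricThreePoint_abs_eq (hq k).1 (hm k)).trans_eq ?_
    rw [← hlaw k, Measure.map_apply (hζm k) (measurableSet_eq_fun (by fun_prop) (by fun_prop))]
    rfl

/-! ### Two counterexamples. -/

/-- Slowly decaying steps: convergence fails for some admissible pair when `ξ ≤ 1 / p`. -/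
theorem exists_admissible_not_tendsto_of_le {d : ℕ} (hd : 0 < d) (A : Matrix (Fin d) (Fin d) ℝ)
    {b xstar : EuclideanSpace ℝ (Fin d)} (hstar : A.toEuclideanLin xstar + b = 0)
    {a : ℕ → ℝ} (ha : ∀ k, 0 < a k) {p : ℝ} (hp : 0 < p) (hap : ¬ Summable fun k => a k ^ p) :
    ∃ (Ω : Type u) (_ : MeasurableSpace Ω) (P : Measure Ω) (_ : IsProbabilityMeasure P)
      (x w : ℕ → Ω → EuclideanSpace ℝ (Fin d)),
      IsLinearSA A b a x w ∧ IsUnbiasedNoise P x w ∧ HasNoiseMomentGrowth P p xstar x w ∧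
      ¬ ∀ᵐ ω ∂P, Tendsto (fun k => x k ω) atTop (𝓝 xstar) := by
  -- Capping at `1` makes `c k ^ p` a probability even when the steps are large; `∑ c k ^ p` still
  -- diverges, since summability would force `c k = a k` eventually.
  set c : ℕ → ℝ := fun k => min (a k) 1 with hc
  have hc0 : ∀ k, 0 < c k := fun k => lt_min (ha k) one_pos
  have hcp : ∀ k, 0 < c k ^ p := fun k => Real.rpow_pos_of_pos (hc0 k) p
  have hns : ¬ Summable fun k => c k ^ p := by
    intro hs
    apply hap
    have h1 : ∀ᶠ k in atTop, c k ^ p < 1 := hs.tendsto_atTop_zero.eventually_lt_const one_pos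
    refine Summable.of_norm_bounded_eventually_nat hs ?_
    filter_upwards [h1] with k hk
    have h2 : c k = a k := by
      refine min_eq_left (le_of_not_gt fun h => ?_)
      have : c k = 1 := min_eq_right h.le
      rw [this, Real.one_rpow] at hk
      exact lt_irrefl _ hk
    rw [Real.norm_of_nonneg (Real.rpow_nonneg (ha k).le p), h2]
  obtain ⟨Ω, mΩ, P, hP, x, w, hsa, hub, hmg, -, hind, hprob⟩ := exists_admissible_pair.{u} hd A b
    xstar a hp (q := fun k => c k ^ p) (m := fun k => (c k)⁻¹)
    (fun k => ⟨(hcp k).le, Real.rpow_le_one (hc0 k).le (min_le_right _ _) hp.le⟩)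
    (fun k => (inv_pos.2 (hc0 k)).le)
    (fun k => by rw [Real.inv_rpow (hc0 k).le, mul_inv_cancel₀ (hcp k).ne'])
  refine ⟨Ω, mΩ, P, hP, x, w, hsa, hub, hmg, fun hconv => ?_⟩
  set s : ℕ → Set Ω := fun k => {ω | ‖w k ω‖ = (c k)⁻¹} with hs
  have hsm : ∀ k, MeasurableSet (s k) := fun k =>
    measurableSet_eq_fun (measurable_norm.comp (hsa.measurable_noise k)) measurable_const
  have hsi : ProbabilityTheory.iIndepSet s P := by
    rw [ProbabilityTheory.iIndepSet_iff_meas_biInter hsm]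
    intro t
    exact hind.measure_inter_preimage_eq_mul t (sets := fun k => {(c k)⁻¹})
      fun k _ => measurableSet_singleton _
  have hsum : ∑' k, P (s k) = ⊤ := by
    by_contra hne
    have h1 : ∑' k, ENNReal.ofReal (c k ^ p) ≠ ⊤ :=
      ne_top_of_le_ne_top hne (ENNReal.tsum_le_tsum hprob)
    have h2 := ENNReal.summable_toReal h1
    simp only [ENNReal.toReal_ofReal (hcp _).le] at h2
    exact hns h2
  have hlim := ProbabilityTheory.measure_limsup_eq_one hsm hsi hsum
  have hae : ∀ᵐ ω ∂P, ω ∈ limsup s atTop :=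
    (mem_ae_iff_prob_eq_one (MeasurableSet.measurableSet_limsup hsm)).2 hlim
  obtain ⟨ω, hω, hfreq⟩ := (hconv.and hae).exists
  rw [mem_limsup_iff_frequently_mem] at hfreq
  -- Along a convergent path both the increments and the drift vanish, whereas `‖w k‖ = 1 / c k`
  -- infinitely often makes `a k ‖w k‖ ≥ max (a k) 1`.
  have h1 : Tendsto (fun k => ‖x (k + 1) ω - x k ω‖ + ‖A.toEuclideanLin (x k ω) + b‖) atTop
      (𝓝 0) := by
    have hA : Continuous A.toEuclideanLin := LinearMap.continuous_of_finiteDimensional _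
    have t1 := ((hω.comp (tendsto_add_atTop_nat 1)).sub hω).norm
    have t2 := (((hA.tendsto xstar).comp hω).add_const b).norm
    have := t1.add t2
    rwa [sub_self, hstar, norm_zero, add_zero] at this
  obtain ⟨k, hk1, hk2⟩ := (hfreq.and_eventually (h1.eventually_lt_const one_pos)).exists
  have hk1 : ‖w k ω‖ = (c k)⁻¹ := hk1
  have h2 : a k • w k ω = (x (k + 1) ω - x k ω) - a k • (A.toEuclideanLin (x k ω) + b) := by
    rw [hsa.recursion k ω, smul_add (a k) (A.toEuclideanLin (x k ω) + b)]
    abel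
  have h3 : a k * ‖w k ω‖ ≤ ‖x (k + 1) ω - x k ω‖ + a k * ‖A.toEuclideanLin (x k ω) + b‖ := by
    have := norm_sub_le (x (k + 1) ω - x k ω) (a k • (A.toEuclideanLin (x k ω) + b))
    rwa [← h2, norm_smul, norm_smul, Real.norm_of_nonneg (ha k).le] at this
  rw [hk1] at h3
  have h4 : 0 ≤ ‖x (k + 1) ω - x k ω‖ := norm_nonneg _
  have h5 : 0 ≤ ‖A.toEuclideanLin (x k ω) + b‖ := norm_nonneg _
  rcases le_total (a k) 1 with hle | hle
  · have : c k = a k := min_eq_left hle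
    rw [this, mul_inv_cancel₀ (ha k).ne'] at h3
    nlinarith
  · have : c k = 1 := min_eq_right hle
    rw [this, inv_one] at h3
    nlinarith

/-- Summable steps: convergence fails for some admissible pair. -/
theorem exists_admissible_not_tendsto_of_summable {d : ℕ} (hd : 0 < d)
    (A : Matrix (Fin d) (Fin d) ℝ)
    {b xstar : EuclideanSpace ℝ (Fin d)} (hstar : A.toEuclideanLin xstar + b = 0)
    {a : ℕ → ℝ} (ha : ∀ k, 0 < a k) {p : ℝ} (hp : 0 < p) (has : Summable a) :
    ∃ (Ω : Type u) (_ : MeasurableSpace Ω) (P : Measure Ω) (_ : IsProbabilityMeasure P)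
      (x w : ℕ → Ω → EuclideanSpace ℝ (Fin d)),
      IsLinearSA A b a x w ∧ IsUnbiasedNoise P x w ∧ HasNoiseMomentGrowth P p xstar x w ∧
      ¬ ∀ᵐ ω ∂P, Tendsto (fun k => x k ω) atTop (𝓝 xstar) := by
  set L := Matrix.toEuclideanCLM (n := Fin d) (𝕜 := ℝ) A with hL
  have hLA : ∀ v, L v = A.toEuclideanLin v := fun v => rfl
  -- `N` is the time of the kick; the tail kept below `1 / 2` starts at `N + 1`, the first step
  -- after it.
  obtain ⟨N, hN⟩ := (((tendsto_sum_nat_add fun k => a k * ‖L‖).comp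
    (tendsto_add_atTop_nat 1)).eventually_lt_const (show (0 : ℝ) < 1 / 2 by norm_num)).exists
  simp only [Function.comp_apply] at hN
  obtain ⟨Ω, mΩ, P, hP, x, w, hsa, hub, hmg, hx0, -, hprob⟩ := exists_admissible_pair.{u} hd A b
    -- The noise is almost surely zero except at time `N`, when it is a random sign times a unit
    -- vector.
    xstar a hp (q := fun _ => 1) (m := fun k => if k = N then 1 else 0)
    (fun k => ⟨zero_le_one, le_rfl⟩) (fun k => by split_ifs <;> simp)
    (fun k => by split_ifs <;> simp [hp.ne'])
  refine ⟨Ω, mΩ, P, hP, x, w, hsa, hub, hmg, fun hconv => ?_⟩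
  have hw : ∀ᵐ ω ∂P, ∀ k, ‖w k ω‖ = if k = N then 1 else 0 := by
    rw [ae_all_iff]
    intro k
    refine (mem_ae_iff_prob_eq_one (measurableSet_eq_fun
      (measurable_norm.comp (hsa.measurable_noise k)) measurable_const)).2 ?_
    exact le_antisymm prob_le_one (by simpa using hprob k)
  obtain ⟨ω, hω, hwω⟩ := (hconv.and hw).exists
  have hw0 : ∀ k, k ≠ N → w k ω = 0 := fun k hk => by
    have := hwω k
    rwa [if_neg hk, norm_eq_zero] at this
  have hrec : ∀ k, x (k + 1) ω - xstar =
      (x k ω - xstar) + a k • (L (x k ω - xstar) + w k ω) := fun k => by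
    rw [hsa.recursion k ω, map_sub, hLA, hLA, eq_neg_of_add_eq_zero_left hstar]
    module
  have hbefore : ∀ k, k ≤ N → x k ω = xstar := by
    intro k
    induction k with
    | zero => exact fun _ => hx0 ω
    | succ k ih =>
      intro hk
      have := hrec k
      rw [ih (by omega), hw0 k (by omega)] at this
      simpa [sub_eq_zero] using this
  have hat : ‖x (N + 1) ω - xstar‖ = a N := by
    rw [hrec N, hbefore N le_rfl, sub_self, map_zero, zero_add, zero_add, norm_smul,
      hwω N, if_pos rfl, mul_one, Real.norm_of_nonneg (ha N).le]
  have hsumm : Summable fun k => a (k + (N + 1)) * ‖L‖ :=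
    (summable_nat_add_iff (f := fun k => a k * ‖L‖) (N + 1)).2 (has.mul_right _)
  have hterm : ∀ k, 0 ≤ a (k + (N + 1)) * ‖L‖ := fun k => mul_nonneg (ha _).le (norm_nonneg _)
  have hpart : ∀ n, ∑ k ∈ Finset.range n, a (k + (N + 1)) * ‖L‖ ≤ 1 / 2 := fun n =>
    (hsumm.sum_le_tsum _ fun k _ => hterm k).trans hN.le
  -- Each later step shrinks the distance to `xstar` by a factor at least `1 - t`, and `(1 - t) (1 -
  -- S) ≥ 1 - (S + t)`; the distance thus stays at least `a N / 2`.
  have hlower : ∀ n, a N * (1 - ∑ k ∈ Finset.range n, a (k + (N + 1)) * ‖L‖) ≤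
      ‖x (n + (N + 1)) ω - xstar‖ := by
    intro n
    induction n with
    | zero => simp [hat]
    | succ n ih =>
      have h1 := hrec (n + (N + 1))
      rw [hw0 _ (by omega), add_zero] at h1
      have h2 : ‖x (n + (N + 1)) ω - xstar‖ - a (n + (N + 1)) * ‖L‖ * ‖x (n + (N + 1)) ω - xstar‖ ≤
          ‖x (n + (N + 1) + 1) ω - xstar‖ := by
        rw [h1]
        refine le_trans ?_ (norm_sub_le_norm_add _ _)
        rw [norm_smul, Real.norm_of_nonneg (ha _).le, mul_assoc]
        have := ha (n + (N + 1))
        gcongr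
        exact L.le_opNorm _
      rw [show n + 1 + (N + 1) = n + (N + 1) + 1 by omega, Finset.sum_range_succ]
      have h3 := hpart (n + 1)
      rw [Finset.sum_range_succ] at h3
      have h4 : 0 ≤ ∑ k ∈ Finset.range n, a (k + (N + 1)) * ‖L‖ :=
        Finset.sum_nonneg fun k _ => hterm k
      have h5 := hterm n
      set t := a (n + (N + 1)) * ‖L‖
      set S := ∑ k ∈ Finset.range n, a (k + (N + 1)) * ‖L‖
      refine le_trans ?_ h2
      calc a N * (1 - (S + t)) ≤ (1 - t) * (a N * (1 - S)) := by
            nlinarith [mul_nonneg (ha N).le (mul_nonneg h4 h5)]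
        _ ≤ (1 - t) * ‖x (n + (N + 1)) ω - xstar‖ := by
            gcongr
            linarith
        _ = _ := by ring
  have hlim : Tendsto (fun n => ‖x (n + (N + 1)) ω - xstar‖) atTop (𝓝 0) := by
    have := ((hω.comp (tendsto_add_atTop_nat (N + 1))).sub_const xstar).norm
    rwa [sub_self, norm_zero] at this
  have hge : a N * (1 / 2) ≤ 0 := by
    refine ge_of_tendsto' hlim fun n => le_trans ?_ (hlower n)
    have := ha N
    gcongr
    linarith [hpart n]
  linarith [ha N]

/-! ### The equivalence. -/

theorem mainTheorem7 {d : ℕ} (hd : 0 < d) (A : Matrix (Fin d) (Fin d) ℝ) (hA : IsHurwitz A)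
    (b : EuclideanSpace ℝ (Fin d)) :
    ∃ xstar : EuclideanSpace ℝ (Fin d),
      (∀ z : EuclideanSpace ℝ (Fin d), A.toEuclideanLin z + b = 0 ↔ z = xstar) ∧
      ∀ p α K ξ : ℝ, 1 < p → 0 < α → 0 < K →
        ((∀ (Ω : Type*) [MeasurableSpace Ω] (P : Measure Ω) [IsProbabilityMeasure P]
            (x w : ℕ → Ω → EuclideanSpace ℝ (Fin d)),
            IsLinearSA A b (fun k => α * ((k : ℝ) + K) ^ (-ξ)) x w →
            IsUnbiasedNoise P x w →
            HasNoiseMomentGrowth P p xstar x w →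
            ∀ᵐ ω ∂P, Tendsto (fun k => x k ω) atTop (𝓝 xstar)) ↔
          ξ ∈ Set.Ioc (1 / p) 1) := by
  obtain ⟨xstar, hx⟩ := hA.existsUnique_zero b
  have hstar : A.toEuclideanLin xstar + b = 0 := (hx xstar).2 rfl
  refine ⟨xstar, hx, fun p α K ξ hp hα hK => ⟨fun h => ?_, fun hξ Ω _ P _ x w hsa hub hmg =>
    hsa.ae_tendsto hd hA hstar hp hα hK hξ hub hmg⟩⟩
  have hp0 : 0 < p := one_pos.trans hp
  have ha : ∀ k : ℕ, 0 < α * ((k : ℝ) + K) ^ (-ξ) := fun k =>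
    mul_pos hα (Real.rpow_pos_of_pos (by positivity) _)
  -- Violating the lower endpoint makes `∑ a_k ^ p` diverge; violating the upper one makes `∑ a_k`
  -- converge. Each case has its own counterexample.
  constructor
  · by_contra hle
    obtain ⟨Ω, mΩ, P, hP, x, w, hsa, hub, hmg, hnot⟩ :=
      exists_admissible_not_tendsto_of_le hd A hstar ha hp0 (by
        simp only [rpow_mul_nat_add_rpow hα hK]
        rw [summable_mul_nat_add_rpow_iff (Real.rpow_pos_of_pos hα p) hK]
        rwa [div_lt_iff₀ hp0] at hle)
    exact hnot (h Ω P x w hsa hub hmg)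
  · by_contra hlt
    obtain ⟨Ω, mΩ, P, hP, x, w, hsa, hub, hmg, hnot⟩ :=
      exists_admissible_not_tendsto_of_summable hd A hstar ha hp0
        ((summable_mul_nat_add_rpow_iff hα hK).2 (not_le.1 hlt))
    exact hnot (h Ω P x w hsa hub hmg)
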